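/- Let $\Gamma=(V,U,E)$ be a finite bipartite (multi)graph, $n=|E|$. Let $E_v$ (resp. $E_u$) be the set of edges at $v\in V$ (resp. $u\in U$). A matchgate formulation on $\Gamma$ consists of tensors $G_v\in(\mathbb C^2)^{\otimes E_v}$ (generators, $v\in V$) and $R_u\in((\mathbb C^2)^*)^{\otimes E_u}$ (recognizers, $u\in U$); its value is $\langle G,R\rangle$ with $G=\bigotimes_v G_v$, $R=\bigotimes_u R_u$. For example, for a satisfiability problem with Boolean variables $V$, clauses $U$ and an edge for each appearance of a variable in a clause, $G_v=\bigotimes_{e\in E_v} a_{e|0}+\bigotimes_{e\in E_v} a_{e|1}$, and $R_u$ is the sum of $\bigotimes_{e\in E_u}\alpha_{e|\epsilon_e}$ over all $\epsilon\in\{0,1\}^{E_u}$ that satisfy the clause $u$, where $a_{e|0},a_{e|1}$ is the standard basis of the copy of $\mathbb C^2$ at $e$ and $\alpha_{e|0},\alpha_{e|1}$ the dual basis. For a skew-symmetric matrix $z$ with ordered rows let $\mathrm{sPf}(z)_I=\mathrm{Pfaff}(z_I)$ and $\mathrm{sPf}^\vee(z)_I=\mathrm{Pfaff}(z_{I^c})$,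 where $z_I$ is the submatrix with rows and columns in $I$; let $\tilde z_{ij}=(-1)^{i+j+1}z_{ij}$. For an order of a set $S$ of edges, index the entries of a tensor over $S$ by subsets $I\subseteq\{1,\dots,|S|\}$: the entry at $I$ is the one with $1$ in the slots in $I$ and $0$ elsewhere; with complementary indexing the entry at $I$ has $0$ in the slots in $I$ and $1$ elsewhere. A vector $T$ indexed by subsets satisfies the Grassmann–Plücker identities if $\sum_{k=1}^{l}(-1)^kT_{A\triangle\{p_k\}}T_{B\triangle\{p_k\}}=0$ for all $A,B$, where $A\triangle B=\{p_1<\dots<p_l\}$. Suppose there are a change of basis of $\mathbb C^2$ (the same for all edges, with the dual change for recognizers) and an order of the edges at each vertex such that, in the new basis, every $G_v$ satisfies the Grassmann–Plücker identities, every $R_u$ satisfies them with complementary indexing, and the entries $\alpha_v=(G_v)_{0\cdots0}$ and $\beta_u=(R_u)_{1\cdots1}$ are non-zero. Put $\alpha=\prod_v\alpha_v$, $\beta=\prod_u\beta_u$. From now on $G$, $R$ are written in the new basis. An order of $E$ is called valid if, in this order, $G/\alpha=\mathrm{sPf}(z)$ and $R/\beta=\mathrm{sPf}^\vee(y)$ for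 some skew-symmetric $n\times n$ matrices $z,y$. (1) For every valid order of $E$, let $x,y$ be the skew-symmetric matrices whose entry at $i<j$ is the entry of $G/\alpha$ at $I=\{i,j\}$, respectively the entry of $R/\beta$ at the $I$ with $I^c=\{i,j\}$. Then $\langle G,R\rangle=\alpha\beta\,\mathrm{Pfaff}(\tilde x+y)$; for a satisfiability problem, this is the number of satisfying assignments. (2) A valid order exists if $\Gamma$ is planar, provided that either the given orders of the edges at the vertices are the clockwise orders of some embedding of $\Gamma$ in the plane, or all $G_v$ and $R_u$ are symmetric, i.e. invariant under all permutations of the edges at the vertex. (Plane embeddings are given combinatorially, as rotation systems of genus zero.) -/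

import Mathlib

open scoped BigOperators

noncomputable section

namespace Holographic

/-! ### Pfaffians -/

/-- The Pfaffian of a skew-symmetric matrix indexed by a finite linearly ordered set: the sum over
all perfect matchings of the index set (given as fixed-point-free involutions `f`) of
`(-1) ^ (number of crossings)` times the product of the entries `A i (f i)` with `i < f i`.
It is `1` on the empty index set and `0` on an index set of odd size. -/
def pfaffian {ι : Type*} [Fintype ι] [LinearOrder ι] (A : Matrix ι ι ℂ) : ℂ :=
  ∑ f : Equiv.Perm ι with ∀ i, f (f i) = i ∧ f i ≠ i,
    (-1) ^ (Finset.univ.filter fun p : ι × ι => p.1 < p.2 ∧ p.2 < f p.1 ∧ f p.1 < f p.2).card *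
      ∏ i with i < f i, A i (f i)

/-- The vector of sub-Pfaffians: the entry at `I` is the Pfaffian of the submatrix of `z` with rows
and columns in `I`. -/
def sPf {n : ℕ} (z : Matrix (Fin n) (Fin n) ℂ) (I : Finset (Fin n)) : ℂ :=
  pfaffian (z.submatrix (Subtype.val : I → Fin n) (Subtype.val : I → Fin n))

/-- The vector of complementary sub-Pfaffians. -/
def sPfDual {n : ℕ} (z : Matrix (Fin n) (Fin n) ℂ) (I : Finset (Fin n)) : ℂ :=
  sPf z Iᶜ

/-- The sign change `z ↦ z̃`, `z̃ i j = (-1) ^ (i + j + 1) * z i j`. (Counting rows and columns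
from `0` or from `1` gives the same sign.) -/
def tilde {n : ℕ} (z : Matrix (Fin n) (Fin n) ℂ) : Matrix (Fin n) (Fin n) ℂ :=
  fun i j => (-1) ^ ((i : ℕ) + (j : ℕ) + 1) * z i j

/-- The skew-symmetric matrix whose entry at `i < j` is the entry of the vector `w` at `{i, j}`. -/
def skewOf {n : ℕ} (w : Finset (Fin n) → ℂ) : Matrix (Fin n) (Fin n) ℂ :=
  fun i j => if i < j then w {i, j} else if j < i then - w {i, j} else 0

/-- The Grassmann–Plücker (matchgate) identities for a vector indexed by the subsets of an ordered
set of size `d`: for all `A`, `B`, with `A ∆ B = {p₁ < ⋯ < p_l}`,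
`∑ i, (-1) ^ i * T (A ∆ {pᵢ}) * T (B ∆ {pᵢ}) = 0`. -/
def GrassmannPlucker {d : ℕ} (T : Finset (Fin d) → ℂ) : Prop :=
  ∀ A B : Finset (Fin d),
    ∑ p ∈ symmDiff A B, (-1) ^ ((symmDiff A B).filter (· < p)).card *
      (T (symmDiff A {p}) * T (symmDiff B {p})) = 0

/-! ### Signatures, i.e. tensors in `⨂ A_e` and `⨂ A_e^*` in coordinates -/

/-- A tensor in `(ℂ²)^{⊗ S}` by its coordinates: `S` is a set of edges, and the coordinate at
`ε : S → Fin 2` is the coefficient of `⨂ e, a_{e | ε e}`. -/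
abbrev Signature (S : Type*) := (S → Fin 2) → ℂ

/-- The index `ε` with `1` in the slots in `I` and `0` elsewhere, the edges being ordered by `o`. -/
def slots {S : Type*} {n : ℕ} (o : S ≃ Fin n) (I : Finset (Fin n)) : S → Fin 2 :=
  fun e => if o e ∈ I then 1 else 0

/-- The vector, indexed by subsets, of a tensor, for the order `o` of the edges. -/
def Signature.vec {S : Type*} {n : ℕ} (T : Signature S) (o : S ≃ Fin n) (I : Finset (Fin n)) : ℂ :=
  T (slots o I)

/-- The same with complementary indexing: the entry at `I` has `0` in the slots in `I` and `1`
elsewhere. -/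
def Signature.covec {S : Type*} {n : ℕ} (T : Signature S) (o : S ≃ Fin n)
    (I : Finset (Fin n)) : ℂ :=
  T (slots o Iᶜ)

/-- Invariance under all permutations of the edges. -/
def Signature.IsSymmetric {S : Type*} (T : Signature S) : Prop :=
  ∀ (π : Equiv.Perm S) (ε : S → Fin 2), T (ε ∘ π) = T ε

/-- The coordinates of a tensor in `(ℂ²)^{⊗ S}` with respect to the new basis
`a'_j = ∑ i, M i j • a_i` of `ℂ²`. -/
def Signature.rebase {S : Type*} [Fintype S] [DecidableEq S] (M : GL (Fin 2) ℂ)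
    (T : Signature S) : Signature S :=
  fun ε => ∑ δ : S → Fin 2, (∏ e, (M⁻¹ : GL (Fin 2) ℂ).val (ε e) (δ e)) * T δ

/-- The coordinates of a tensor in the dual space with respect to the dual of the new basis
`a'_j = ∑ i, M i j • a_i`, i.e. its values on the tensor products of new basis vectors. -/
def Signature.dualRebase {S : Type*} [Fintype S] [DecidableEq S] (M : GL (Fin 2) ℂ)
    (T : Signature S) : Signature S :=
  fun ε => ∑ δ : S → Fin 2, (∏ e, M.val (δ e) (ε e)) * T δ

/-! ### Matchgate formulations -/

/-- The set of edges with end `v`, where `f` assigns to each edge its end on one side. -/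
abbrev Star {E W : Type*} (f : E → W) (v : W) := {e : E // f e = v}

/-- A matchgate formulation on a bipartite (multi)graph with vertex classes `V`, `U` and edge set
`E`: a generator at each vertex of `V` and a recognizer at each vertex of `U`. -/
structure Formulation (V U E : Type*) where
  /-- the end of an edge in `V` -/
  left : E → V
  /-- the end of an edge in `U` -/
  right : E → U
  /-- the generators, in the basis `a_{e|0}, a_{e|1}` -/
  G : ∀ v : V, Signature (Star left v)
  /-- the recognizers, in the dual basis -/
  R : ∀ u : U, Signature (Star right u)

namespace Formulation

variable {V U E : Type*} [Fintype V] [Fintype U] [Fintype E]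
  [DecidableEq V] [DecidableEq U] [DecidableEq E]

/-- The pairing `⟨G, R⟩` of `G = ⨂ v, G_v` with `R = ⨂ u, R_u`. -/
def pairing (Φ : Formulation V U E) : ℂ :=
  ∑ ε : E → Fin 2, (∏ v, Φ.G v fun e => ε e.1) * ∏ u, Φ.R u fun e => ε e.1

/-- The formulation after the change of basis `M` of `ℂ²`, the same for every edge, and the dual
change of basis on the recognizers. -/
def rebase (Φ : Formulation V U E) (M : GL (Fin 2) ℂ) : Formulation V U E where
  left := Φ.left
  right := Φ.right
  G v := (Φ.G v).rebase M
  R u := (Φ.R u).dualRebase M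

/-- `α = ∏ α_v`, the first entry of `G`. -/
def alpha (Φ : Formulation V U E) : ℂ := ∏ v, Φ.G v fun _ => 0

/-- `β = ∏ β_u`, the last entry of `R`. -/
def beta (Φ : Formulation V U E) : ℂ := ∏ u, Φ.R u fun _ => 1

/-- The tensor `G = ⨂ v, G_v`, normalized so that its first entry is one. -/
def normG (Φ : Formulation V U E) : Signature E :=
  fun ε => (∏ v, Φ.G v fun e => ε e.1) / Φ.alpha

/-- The tensor `R = ⨂ u, R_u`, normalized so that its last entry is one. -/
def normR (Φ : Formulation V U E) : Signature E :=
  fun ε => (∏ u, Φ.R u fun e => ε e.1) / Φ.beta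

/-- An edge order is valid if, in this order, the normalized `G` is the vector of sub-Pfaffians and
the normalized `R` the vector of complementary sub-Pfaffians of skew-symmetric matrices. -/
def IsValidOrder (Φ : Formulation V U E) (o : E ≃ Fin (Fintype.card E)) : Prop :=
  ∃ z y : Matrix (Fin (Fintype.card E)) (Fin (Fintype.card E)) ℂ,
    z.transpose = -z ∧ y.transpose = -y ∧
      Φ.normG.vec o = sPf z ∧ Φ.normR.vec o = sPfDual y

/-- The matrix `x`: its entry at `i < j` is the entry of the normalized `G` at `I = {i, j}`. -/
def xMatrix (Φ : Formulation V U E) (o : E ≃ Fin (Fintype.card E)) :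
    Matrix (Fin (Fintype.card E)) (Fin (Fintype.card E)) ℂ :=
  skewOf (Φ.normG.vec o)

/-- The matrix `y`: its entry at `i < j` is the entry of the normalized `R` at the `I` with
`Iᶜ = {i, j}`. -/
def yMatrix (Φ : Formulation V U E) (o : E ≃ Fin (Fintype.card E)) :
    Matrix (Fin (Fintype.card E)) (Fin (Fintype.card E)) ℂ :=
  skewOf (Φ.normR.covec o)

end Formulation

/-! ### Planarity -/

/-- An order of the edges at each vertex. -/
abbrev LocalOrders {E W : Type*} [Fintype E] [DecidableEq W] (f : E → W) :=
  ∀ v : W, Star f v ≃ Fin (Fintype.card (Star f v))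

/-- The permutation of the edges that sends every edge to the next one, cyclically, at its end. -/
def rotation {E W : Type*} [Fintype E] [DecidableEq W] {f : E → W} (o : LocalOrders f) :
    Equiv.Perm E :=
  (Equiv.sigmaFiberEquiv f).permCongr
    (Equiv.sigmaCongrRight fun v => (o v).symm.permCongr (finRotate _))

/-- The number of cycles of a permutation, fixed points included. -/
def numCycles {E : Type*} (σ : Equiv.Perm E) : ℕ :=
  Nat.card (Quotient (Equiv.Perm.SameCycle.setoid σ))

/-- Orders of the edges at the vertices of a bipartite graph are the clockwise orders of an
embedding in the plane (equivalently, the sphere): the rotation system that they define has genus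
zero. Its vertices (of positive degree) are the cycles of the two rotations `σ` and `τ`, its faces
the cycles of `σ * τ`, its connected components the orbits of the group generated by `σ` and `τ`,
and genus zero means `#vertices - #edges + #faces = 2 * #components`. -/
def IsPlaneOrders {V U E : Type*} [Fintype E] [DecidableEq V] [DecidableEq U]
    {l : E → V} {r : E → U} (oV : LocalOrders l) (oU : LocalOrders r) : Prop :=
  numCycles (rotation oV) + numCycles (rotation oU) + numCycles (rotation oV * rotation oU) =
    Nat.card E + 2 * Nat.card (MulAction.orbitRel.Quotient
      (Subgroup.closure ({rotation oV, rotation oU} : Set (Equiv.Perm E))) E)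

/-- A bipartite graph is planar: it has an embedding in the plane. -/
def IsPlanar {V U E : Type*} [Fintype E] [DecidableEq V] [DecidableEq U]
    (l : E → V) (r : E → U) : Prop :=
  ∃ (oV : LocalOrders l) (oU : LocalOrders r), IsPlaneOrders oV oU

/-! ### Satisfiability problems -/

/-- A satisfiability problem: Boolean variables `V`, clauses `U`, and an edge in `E` for each
appearance of a variable in a clause; each clause is a condition on the values of the variables
appearing in it. -/
structure SatProblem (V U E : Type*) where
  left : E → V
  right : E → U
  clause : ∀ u : U, (Star right u → Fin 2) → Prop

namespace SatProblem

variable {V U E : Type*}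

/-- The number of assignments that satisfy all clauses. -/
def numSat (P : SatProblem V U E) : ℕ :=
  Nat.card {a : V → Fin 2 // ∀ u, P.clause u fun e => a (P.left e.1)}

open Classical in
/-- The formulation of a satisfiability problem: the generator at a variable is
`⨂ a_{e|0} + ⨂ a_{e|1}`, the recognizer at a clause is the sum of the `⨂ α_{e|ε_e}` over the `ε`
that satisfy the clause. -/
def formulation (P : SatProblem V U E) : Formulation V U E where
  left := P.left
  right := P.right
  G _ := fun ε => (if ∀ e, ε e = 0 then 1 else 0) + (if ∀ e, ε e = 1 then 1 else 0)
  R u := fun ε => if P.clause u ε then 1 else 0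

end SatProblem

end Holographic

end

/-! The value. The pairing does not depend on the basis, so it can be computed in the new one. In a
valid order it is `αβ` times the sum over `J` of `Pfaff(z_J) * Pfaff(y_{Jᶜ})`. The Pfaffian of a sum
of two matrices is the same kind of sum, but with the sign of the shuffle that separates `J` from
`Jᶜ` (`sPf_add`). The sign change `tilde` cancels exactly this shuffle sign
(`shuffleSign_mul_sPf_tilde`). Finally `z` and `y` are read off from their sub-Pfaffians of size two
(`skewOf_sPf`). Identities between Pfaffians are proved by one principle: a vector that is `1` at
the empty set and expands along the first row is a vector of sub-Pfaffians (`eq_sPf_of_expand`).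

Existence of a valid order, topology. In a plane bipartite graph there is a closed curve that
crosses every edge once and separates the two classes of vertices. Reading the edges along the curve
gives an order for which the rotation at `V` is noncrossing, while the rotation at `U` is
noncrossing for the reverse order. Combinatorially (`GenusZero.hasNoncrossingOrder`), two vertices
of one class that lie on a common face are joined: this loses a vertex, gains a face and keeps genus
zero. Once nothing can be joined, each component has one vertex in each class, Euler's formula
forces `σ * τ = 1`, and a noncrossing order for `σ` suffices. Undoing a join splits a cycle, and
splitting preserves being noncrossing (`Noncrossing.mul_swap`).

Existence of a valid order, algebra. A Grassmann–Plücker vector with non-zero entry at the empty set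
satisfies, after normalization, the Pfaffian expansion along every row and vanishes on odd sets. In
a product over vertices, the sign in the global order may differ from the local one through edges at
other vertices, and through the choice of the first edge in a cyclic order. Both effects are
invisible by parity (`Compatible.neg_one_pow_between`), so the product again expands like a
Pfaffian. -/

namespace Holographic

/-! ### Expansion of Pfaffians -/

/-- The number of elements of `I` strictly between `p` and `q`, for the order given by `f`. -/
def between {E : Type*} (f : E → ℤ) (I : Finset E) (p q : E) : ℕ :=
  (I.filter fun r => f p < f r ∧ f r < f q ∨ f q < f r ∧ f r < f p).card

/-- The position of an element of `Fin n`, as an integer. -/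
def pos {n : ℕ} (i : Fin n) : ℤ := ((i : ℕ) : ℤ)

/-- The term of an involution, its fixed points being ignored, in a Pfaffian. -/
def matchingTerm {n : ℕ} (z : Matrix (Fin n) (Fin n) ℂ) (f : Equiv.Perm (Fin n)) : ℂ :=
  (-1) ^ (Finset.univ.filter fun p : Fin n × Fin n =>
      p.1 < p.2 ∧ p.2 < f p.1 ∧ f p.1 < f p.2).card * ∏ i with i < f i, z i (f i)

/-- A matching of `I` extends by the identity to an involution of `Fin n` that moves exactly `I`,
and fixed points take part in no arc or crossing. All submatrices are thus treated inside one
permutation group. -/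
theorem sPf_eq_sum_involutions {n : ℕ} (z : Matrix (Fin n) (Fin n) ℂ) (I : Finset (Fin n)) :
    sPf z I = ∑ f : Equiv.Perm (Fin n) with ∀ i, f (f i) = i ∧ (f i ≠ i ↔ i ∈ I),
      matchingTerm z f := by
  unfold sPf pfaffian
  refine Finset.sum_bij (fun f _ => Equiv.Perm.ofSubtype f) ?_ ?_ ?_ ?_
  · intro f hf
    simp only [Finset.mem_filter, Finset.mem_univ, true_and] at hf ⊢
    intro i
    by_cases hi : i ∈ I
    · have h1 := Equiv.Perm.ofSubtype_apply_of_mem f hi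
      have h2 := Equiv.Perm.ofSubtype_apply_of_mem f (f ⟨i, hi⟩).2
      have h3 := hf ⟨i, hi⟩
      refine ⟨?_, ?_⟩
      · rw [h1]; simp only [Subtype.coe_eta] at h2; rw [h2, h3.1]
      · simp only [hi, iff_true]
        rw [h1]
        intro h
        exact h3.2 (Subtype.ext h)
    · have h1 := Equiv.Perm.ofSubtype_apply_of_not_mem f hi
      simp [h1, hi]
  · intro f _ g _ h
    exact Equiv.Perm.ofSubtype_injective h
  · intro g hg
    simp only [Finset.mem_filter, Finset.mem_univ, true_and] at hg
    have hmem : ∀ x, g x ∈ I ↔ x ∈ I := by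
      intro x
      rw [← (hg x).2, ← (hg (g x)).2]
      rw [(hg x).1]
      exact ⟨fun h => h.symm, fun h => h.symm⟩
    have hext : Equiv.Perm.ofSubtype (g.subtypePerm (p := (· ∈ I)) hmem) = g :=
      Equiv.Perm.ofSubtype_subtypePerm hmem (fun x hx => (hg x).2.1 hx)
    refine ⟨g.subtypePerm hmem, ?_, hext⟩
    simp only [Finset.mem_filter, Finset.mem_univ, true_and]
    intro i
    refine ⟨Subtype.ext (hg i).1, fun h => ?_⟩
    exact (hg i).2.2 i.2 (congrArg Subtype.val h)
  · intro f hf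
    unfold matchingTerm
    have hval : ∀ i : I, Equiv.Perm.ofSubtype f (i : Fin n) = (f i : Fin n) := fun i =>
      Equiv.Perm.ofSubtype_apply_coe f i
    have hmem : ∀ i, Equiv.Perm.ofSubtype f i ≠ i → i ∈ I := by
      intro i h
      by_contra hi
      exact h (Equiv.Perm.ofSubtype_apply_of_not_mem f hi)
    congr 1
    · congr 1
      refine Finset.card_bij (fun p _ => ((p.1 : Fin n), (p.2 : Fin n))) ?_ ?_ ?_
      · intro p hp
        simp only [Finset.mem_filter, Finset.mem_univ, true_and, hval] at hp ⊢
        exact hp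
      · rintro ⟨a, b⟩ _ ⟨c, d⟩ _ h
        simp only [Prod.mk.injEq] at h
        exact Prod.ext (Subtype.ext h.1) (Subtype.ext h.2)
      · rintro ⟨a, b⟩ hp
        simp only [Finset.mem_filter, Finset.mem_univ, true_and] at hp
        have ha : a ∈ I := hmem a (by
          intro h; rw [h] at hp; exact absurd (hp.1.trans hp.2.1) (lt_irrefl _))
        have hb : b ∈ I := hmem b (by
          intro h; rw [h] at hp; exact absurd (hp.2.1.trans hp.2.2) (lt_irrefl _))
        refine ⟨(⟨a, ha⟩, ⟨b, hb⟩), ?_, rfl⟩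
        have h1 := hval ⟨a, ha⟩
        have h2 := hval ⟨b, hb⟩
        simp only at h1 h2
        rw [h1, h2] at hp
        simp only [Finset.mem_filter, Finset.mem_univ, true_and]
        exact hp
    · refine Finset.prod_bij (fun i _ => (i : Fin n)) ?_ ?_ ?_ ?_
      · intro i hi
        simp only [Finset.mem_filter, Finset.mem_univ, true_and, hval] at hi ⊢
        exact hi
      · intro a _ b _ h
        exact Subtype.ext h
      · intro b hb
        simp only [Finset.mem_filter, Finset.mem_univ, true_and] at hb
        have hbI : b ∈ I := hmem b (ne_of_gt hb)
        refine ⟨⟨b, hbI⟩, ?_, rfl⟩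
        have h2 := hval ⟨b, hbI⟩
        simp only at h2
        rw [h2] at hb
        simp only [Finset.mem_filter, Finset.mem_univ, true_and]
        exact hb
      · intro i _
        simp [hval, Matrix.submatrix_apply]

theorem sPf_empty {n : ℕ} (z : Matrix (Fin n) (Fin n) ℂ) : sPf z ∅ = 1 := by
  rw [sPf_eq_sum_involutions]
  rw [Finset.sum_eq_single (1 : Equiv.Perm (Fin n))]
  · unfold matchingTerm
    have h1 : (Finset.univ.filter fun p : Fin n × Fin n =>
      p.1 < p.2 ∧ p.2 < (1 : Equiv.Perm (Fin n)) p.1 ∧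
        (1 : Equiv.Perm (Fin n)) p.1 < (1 : Equiv.Perm (Fin n)) p.2) = ∅ := by
      refine Finset.filter_eq_empty_iff.2 fun p _ h => ?_
      exact absurd (h.1.trans h.2.1) (lt_irrefl _)
    rw [h1]
    simp
  · intro f hf hne
    exfalso
    apply hne
    simp only [Finset.mem_filter, Finset.mem_univ, true_and] at hf
    ext i
    have := (hf i).2
    simp only [Finset.notMem_empty, iff_false, not_not] at this
    simp [this]
  · intro h
    exfalso
    apply h
    simp

theorem even_card_of_involution {α : Type*} [DecidableEq α] (s : Finset α) (g : α → α)
    (h1 : ∀ a ∈ s, g a ∈ s) (h2 : ∀ a ∈ s, g (g a) = a) (h3 : ∀ a ∈ s, g a ≠ a) :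
    Even s.card := by
  have h : ∏ _x ∈ s, (-1 : ℤ) = 1 :=
    Finset.prod_involution (fun a _ => g a) (fun a _ => by norm_num) (fun a ha _ => h3 a ha)
      (fun a ha => h1 a ha) (fun a ha => h2 a ha)
  rw [Finset.prod_const] at h
  exact (neg_one_pow_eq_one_iff_even (by norm_num)).1 h

/-- Removing the arc from the first point `p` to `q` destroys one crossing for each point strictly
between them that is matched beyond `q`. The other points between `p` and `q` are matched among
themselves, so their number is even and the sign is that of all points between. -/
theorem matchingTerm_swap_mul {n : ℕ} (z : Matrix (Fin n) (Fin n) ℂ) {I : Finset (Fin n)}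
    {p q : Fin n} (hp : p ∈ I) (hmin : ∀ i ∈ I, p ≤ i) {f : Equiv.Perm (Fin n)}
    (hf : ∀ i, f (f i) = i ∧ (f i ≠ i ↔ i ∈ I)) (hq : f p = q) :
    matchingTerm z f =
      (-1) ^ between pos I p q * (z p q * matchingTerm z (Equiv.swap p q * f)) := by
  have hqp : f q = p := by rw [← hq]; exact (hf p).1
  have hpq : p ≠ q := by
    intro h
    exact (hf p).2.2 hp (hq.trans h.symm)
  have hqI : q ∈ I := (hf q).2.1 (by rw [hqp]; exact hpq)
  have hlt : p < q := lt_of_le_of_ne (hmin q hqI) hpq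
  set g := Equiv.swap p q * f with hg
  have gp : g p = p := by simp [hg, hq]
  have gq : g q = q := by simp [hg, hqp]
  have gi : ∀ i, i ≠ p → i ≠ q → g i = f i := by
    intro i h1 h2
    simp only [hg, Equiv.Perm.mul_apply]
    apply Equiv.swap_apply_of_ne_of_ne
    · intro h; apply h2; rw [← hq, ← h]; exact ((hf i).1).symm
    · intro h; apply h1; rw [← hqp, ← h]; exact ((hf i).1).symm
  have fge : ∀ i, p ≤ i → p ≤ f i := by
    intro i hi
    by_cases h : i ∈ I
    · apply hmin
      rw [← (hf (f i)).2, (hf i).1]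
      exact fun h' => (hf i).2.2 h h'.symm
    · have : f i = i := by
        by_contra h'; exact h ((hf i).2.1 h')
      rw [this]; exact hi
  have hIne : ∀ i, f i ≠ i → p ≤ i := fun i h => hmin i ((hf i).2.1 h)
  have fp : ∀ i, f i = p → i = q := by
    intro i h; rw [← hq, ← h]; exact ((hf i).1).symm
  have fq : ∀ i, f i = q → i = p := by
    intro i h; rw [← hqp, ← h]; exact ((hf i).1).symm
  unfold matchingTerm
  have hprod : ∏ i with i < f i, z i (f i) = z p q * ∏ i with i < g i, z i (g i) := by
    have hs : (Finset.univ.filter fun i => i < f i) =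
        insert p (Finset.univ.filter fun i => i < g i) := by
      ext i
      simp only [Finset.mem_filter, Finset.mem_univ, true_and, Finset.mem_insert]
      by_cases h1 : i = p
      · subst h1; simp [hq, hlt]
      by_cases h2 : i = q
      · subst h2; simp [hqp, gq, h1, hlt.le]
      · simp [gi i h1 h2, h1]
    rw [hs, Finset.prod_insert (by simp [gp]), hq]
    congr 1
    apply Finset.prod_congr rfl
    intro i hi
    simp only [Finset.mem_filter, Finset.mem_univ, true_and] at hi
    rw [gi i (by rintro rfl; simp [gp] at hi) (by rintro rfl; simp [gq] at hi)]
  have hcr : (Finset.univ.filter fun x : Fin n × Fin n =>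
        x.1 < x.2 ∧ x.2 < f x.1 ∧ f x.1 < f x.2).card =
      (Finset.univ.filter fun x : Fin n × Fin n =>
        x.1 < x.2 ∧ x.2 < g x.1 ∧ g x.1 < g x.2).card +
      (I.filter fun r => (p < r ∧ r < q) ∧ q < f r).card := by
    have hs : (Finset.univ.filter fun x : Fin n × Fin n =>
        x.1 < x.2 ∧ x.2 < f x.1 ∧ f x.1 < f x.2) =
        (Finset.univ.filter fun x : Fin n × Fin n =>
        x.1 < x.2 ∧ x.2 < g x.1 ∧ g x.1 < g x.2) ∪
        (I.filter fun r => (p < r ∧ r < q) ∧ q < f r).image (fun r => (p, r)) := by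
      ext ⟨a, b⟩
      simp only [Finset.mem_filter, Finset.mem_univ, true_and, Finset.mem_union, Finset.mem_image,
        Prod.mk.injEq]
      constructor
      · rintro ⟨h1, h2, h3⟩
        have hpb : p ≤ b := hIne b (by
          intro h; rw [h] at h3; exact absurd (h2.trans h3) (lt_irrefl _))
        have hpa : p ≤ a := hIne a (by
          intro h; rw [h] at h2; exact absurd (h2.trans h1) (lt_irrefl _))
        by_cases hap : a = p
        · subst hap
          right
          rw [hq] at h2 h3
          exact ⟨b, ⟨(hf b).2.1 (ne_of_gt (h2.trans h3)), ⟨h1, h2⟩, h3⟩, rfl, rfl⟩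
        · left
          have haq : a ≠ q := by
            rintro rfl; rw [hqp] at h2; exact absurd h2 (not_lt.2 hpb)
          have hbq : b ≠ q := by
            rintro rfl; rw [hqp] at h3; exact absurd h3 (not_lt.2 (fge a hpa))
          have hbp : b ≠ p := by
            rintro rfl; exact absurd h1 (not_lt.2 hpa)
          rw [gi a hap haq, gi b hbp hbq]
          exact ⟨h1, h2, h3⟩
      · rintro (⟨h1, h2, h3⟩ | ⟨r, ⟨_, ⟨h2, h3⟩, h4⟩, rfl, rfl⟩)
        · have hap : a ≠ p := by
            rintro rfl; rw [gp] at h2; exact absurd (h2.trans h1) (lt_irrefl _)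
          have haq : a ≠ q := by
            rintro rfl; rw [gq] at h2; exact absurd (h2.trans h1) (lt_irrefl _)
          have hbp : b ≠ p := by
            rintro rfl; rw [gp] at h3; exact absurd (h2.trans h3) (lt_irrefl _)
          have hbq : b ≠ q := by
            rintro rfl; rw [gq] at h3; exact absurd (h2.trans h3) (lt_irrefl _)
          rw [gi a hap haq, gi b hbp hbq] at *
          exact ⟨h1, h2, h3⟩
        · rw [hq]; exact ⟨h2, h3, h4⟩
    rw [hs, Finset.card_union_of_disjoint, Finset.card_image_of_injective]
    · intro a b h; exact (Prod.mk.inj h).2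
    · rw [Finset.disjoint_left]
      rintro ⟨a, b⟩ h1 h2
      simp only [Finset.mem_filter, Finset.mem_univ, true_and, Finset.mem_image,
        Prod.mk.injEq] at h1 h2
      obtain ⟨r, _, rfl, rfl⟩ := h2
      rw [gp] at h1
      exact absurd (h1.1.trans h1.2.1) (lt_irrefl _)
  have hbt : ∃ k, between pos I p q =
      (I.filter fun r => (p < r ∧ r < q) ∧ q < f r).card + (k + k) := by
    have hev : Even (I.filter fun r => (p < r ∧ r < q) ∧ ¬ q < f r).card := by
      apply even_card_of_involution _ f
      · intro a ha
        simp only [Finset.mem_filter, not_lt] at ha ⊢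
        obtain ⟨haI, ⟨h1, h2⟩, h3⟩ := ha
        refine ⟨?_, ⟨lt_of_le_of_ne (fge a h1.le) ?_, lt_of_le_of_ne h3 ?_⟩, ?_⟩
        · rw [← (hf (f a)).2, (hf a).1]
          exact fun h' => (hf a).2.2 haI h'.symm
        · intro h; exact absurd (fp a h.symm) (ne_of_lt h2)
        · intro h; exact absurd (fq a h) (ne_of_gt h1)
        · rw [(hf a).1]; exact h2.le
      · intro a _; exact (hf a).1
      · intro a ha
        exact (hf a).2.2 (Finset.mem_filter.1 ha).1
    obtain ⟨k, hk⟩ := hev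
    refine ⟨k, ?_⟩
    rw [← hk, ← Finset.filter_filter (fun r => p < r ∧ r < q),
      ← Finset.filter_filter (fun r => p < r ∧ r < q), Finset.card_filter_add_card_filter_not]
    unfold between pos
    congr 1
    ext r
    simp only [Finset.mem_filter, Nat.cast_lt, Fin.val_fin_lt, and_congr_right_iff]
    intro _
    constructor
    · rintro (h | h)
      · exact h
      · exact absurd (h.1.trans h.2) (not_lt.2 hlt.le)
    · exact Or.inl
  obtain ⟨k, hk⟩ := hbt
  rw [hprod, hcr, hk, pow_add, pow_add _ _ (k + k), Even.neg_one_pow ⟨k, rfl⟩]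
  ring

/-- Expansion of a sub-Pfaffian along its first row. -/
theorem sPf_expand {n : ℕ} (z : Matrix (Fin n) (Fin n) ℂ) {I : Finset (Fin n)} {p : Fin n}
    (hp : p ∈ I) (hmin : ∀ i ∈ I, p ≤ i) :
    sPf z I = ∑ q ∈ I.erase p,
      (-1) ^ between pos I p q * (z p q * sPf z ((I.erase p).erase q)) := by
  have hmaps : ∀ f ∈ Finset.univ.filter (fun f : Equiv.Perm (Fin n) =>
      ∀ i, f (f i) = i ∧ (f i ≠ i ↔ i ∈ I)), f p ∈ I.erase p := by
    intro f hf
    simp only [Finset.mem_filter, Finset.mem_univ, true_and] at hf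
    have h1 := (hf p).2.2 hp
    refine Finset.mem_erase.2 ⟨h1, ?_⟩
    rw [← (hf (f p)).2, (hf p).1]
    exact h1.symm
  rw [sPf_eq_sum_involutions, ← Finset.sum_fiberwise_of_maps_to hmaps]
  apply Finset.sum_congr rfl
  intro q hq
  have hqp : q ≠ p := (Finset.mem_erase.1 hq).1
  have hqI : q ∈ I := (Finset.mem_erase.1 hq).2
  rw [sPf_eq_sum_involutions, Finset.mul_sum, Finset.mul_sum]
  have key : ∀ f g : Equiv.Perm (Fin n), f = Equiv.swap p q * g →
      (((∀ i, f (f i) = i ∧ (f i ≠ i ↔ i ∈ I)) ∧ f p = q) ↔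
      (∀ i, g (g i) = i ∧ (g i ≠ i ↔ i ∈ (I.erase p).erase q))) := by
    intro f g hfg
    have hgf : g = Equiv.swap p q * f := by rw [hfg, Equiv.swap_mul_self_mul]
    constructor
    · rintro ⟨hf, hfp⟩ i
      have hfq : f q = p := by rw [← hfp]; exact (hf p).1
      have gi : ∀ i, i ≠ p → i ≠ q → g i = f i := by
        intro i h1 h2
        rw [hgf, Equiv.Perm.mul_apply]
        apply Equiv.swap_apply_of_ne_of_ne
        · intro h; apply h2; rw [← hfp, ← h]; exact ((hf i).1).symm
        · intro h; apply h1; rw [← hfq, ← h]; exact ((hf i).1).symm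
      by_cases h1 : i = p
      · subst h1
        have : g i = i := by rw [hgf, Equiv.Perm.mul_apply, hfp, Equiv.swap_apply_right]
        simp [this]
      by_cases h2 : i = q
      · subst h2
        have : g i = i := by rw [hgf, Equiv.Perm.mul_apply, hfq, Equiv.swap_apply_left]
        simp [this]
      · rw [gi i h1 h2, gi (f i), (hf i).1, (hf i).2]
        · simp [h1, h2]
        · intro h; apply h2; rw [← hfp, ← h]; exact ((hf i).1).symm
        · intro h; apply h1; rw [← hfq, ← h]; exact ((hf i).1).symm
    · intro hg
      have gp : g p = p := by
        by_contra h; have := (hg p).2.1 h; simp at this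
      have gq : g q = q := by
        by_contra h; have := (hg q).2.1 h; simp at this
      have fp : f p = q := by rw [hfg, Equiv.Perm.mul_apply, gp, Equiv.swap_apply_left]
      have fq : f q = p := by rw [hfg, Equiv.Perm.mul_apply, gq, Equiv.swap_apply_right]
      have fi : ∀ i, i ≠ p → i ≠ q → f i = g i := by
        intro i h1 h2
        rw [hfg, Equiv.Perm.mul_apply]
        apply Equiv.swap_apply_of_ne_of_ne
        · intro h; exact h1 (g.injective (h.trans gp.symm))
        · intro h; exact h2 (g.injective (h.trans gq.symm))
      refine ⟨fun i => ?_, fp⟩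
      by_cases h1 : i = p
      · subst h1; simp [fp, fq, hqp, hp]
      by_cases h2 : i = q
      · subst h2; simp [fp, fq, hqp.symm, hqI]
      · rw [fi i h1 h2, fi (g i), (hg i).1, (hg i).2]
        · simp [h1, h2]
        · intro h; exact h1 (g.injective (h.trans gp.symm))
        · intro h; exact h2 (g.injective (h.trans gq.symm))
  refine Finset.sum_bij (fun f _ => Equiv.swap p q * f) ?_ ?_ ?_ ?_
  · intro f hf
    simp only [Finset.mem_filter, Finset.mem_univ, true_and] at hf ⊢
    exact (key f _ (by rw [Equiv.swap_mul_self_mul])).1 hf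
  · intro f _ g _ h
    exact mul_left_cancel h
  · intro g hg
    simp only [Finset.mem_filter, Finset.mem_univ, true_and] at hg
    refine ⟨Equiv.swap p q * g, ?_, by rw [Equiv.swap_mul_self_mul]⟩
    simp only [Finset.mem_filter, Finset.mem_univ, true_and]
    exact (key _ g rfl).2 hg
  · intro f hf
    simp only [Finset.mem_filter, Finset.mem_univ, true_and] at hf
    exact matchingTerm_swap_mul z hp hmin hf.1 hf.2

/-- The expansion along the first row determines the vector of sub-Pfaffians. -/
theorem eq_sPf_of_expand {n : ℕ} (z : Matrix (Fin n) (Fin n) ℂ) (T : Finset (Fin n) → ℂ)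
    (h0 : T ∅ = 1)
    (h : ∀ (I : Finset (Fin n)) (p : Fin n), p ∈ I → (∀ i ∈ I, p ≤ i) →
      T I = ∑ q ∈ I.erase p, (-1) ^ between pos I p q * (z p q * T ((I.erase p).erase q))) :
    T = sPf z := by
  funext I
  induction I using Finset.strongInduction with
  | H I ih =>
    rcases I.eq_empty_or_nonempty with rfl | hne
    · rw [h0, sPf_empty]
    · have hp := I.min'_mem hne
      have hmin : ∀ i ∈ I, I.min' hne ≤ i := fun i hi => I.min'_le i hi
      rw [h I _ hp hmin, sPf_expand z hp hmin]
      apply Finset.sum_congr rfl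
      intro q _
      rw [ih]
      exact (Finset.erase_subset _ _).trans_ssubset (Finset.erase_ssubset hp)

/-! ### The Pfaffian of a sum -/

theorem pfaffian_eq_sPf_univ {n : ℕ} (z : Matrix (Fin n) (Fin n) ℂ) :
    pfaffian z = sPf z Finset.univ := by
  rw [sPf_eq_sum_involutions]
  unfold pfaffian matchingTerm
  simp

/-- The sign of moving the elements of `J` in front of those of `K`. -/
def shuffleSign {n : ℕ} (J K : Finset (Fin n)) : ℂ :=
  ∏ j ∈ J, ∏ k ∈ K, if k < j then -1 else 1

/-- As a product of signs over `I`, the sign can be split over disjoint unions and compared factor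
by factor. -/
theorem neg_one_pow_between {n : ℕ} (I : Finset (Fin n)) (p q : Fin n) :
    (-1 : ℂ) ^ between pos I p q =
      ∏ r ∈ I, if p < r ∧ r < q ∨ q < r ∧ r < p then -1 else 1 := by
  rw [Finset.prod_ite, Finset.prod_const, Finset.prod_const_one, mul_one]
  simp [between, pos]

theorem neg_one_pow_between_union {n : ℕ} {J K : Finset (Fin n)} (h : Disjoint J K)
    (p q : Fin n) :
    (-1 : ℂ) ^ between pos (J ∪ K) p q =
      (-1) ^ between pos J p q * (-1) ^ between pos K p q := by
  simp only [neg_one_pow_between, Finset.prod_union h]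

theorem neg_one_pow_mul_self (k : ℕ) : (-1 : ℂ) ^ k * (-1) ^ k = 1 := by
  rw [← mul_pow]; simp

/-- An element of `K` below both `p` and `q` contributes two signs, which cancel; only the elements
between them remain. -/
theorem shuffleSign_erase_left {n : ℕ} {J K : Finset (Fin n)} {p q : Fin n} (hp : p ∈ J)
    (hq : q ∈ J.erase p) (hJK : Disjoint J K) :
    shuffleSign J K = (-1) ^ between pos K p q * shuffleSign ((J.erase p).erase q) K := by
  unfold shuffleSign
  rw [← Finset.mul_prod_erase J _ hp, ← Finset.mul_prod_erase (J.erase p) _ hq, ← mul_assoc,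
    ← Finset.prod_mul_distrib, neg_one_pow_between]
  congr 1
  refine Finset.prod_congr rfl fun k hk => ?_
  have h1 : k ≠ p := fun h => Finset.disjoint_left.1 hJK hp (h ▸ hk)
  have h2 : k ≠ q := fun h => Finset.disjoint_left.1 hJK (Finset.mem_of_mem_erase hq) (h ▸ hk)
  rcases lt_or_gt_of_ne h1 with h1 | h1 <;> rcases lt_or_gt_of_ne h2 with h2 | h2 <;>
    simp [h1, h2, h1.not_gt, h2.not_gt]

theorem shuffleSign_erase_right {n : ℕ} {J K : Finset (Fin n)} {p q : Fin n} (hp : p ∈ K)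
    (hq : q ∈ K.erase p) (hJK : Disjoint J K) :
    shuffleSign J K = (-1) ^ between pos J p q * shuffleSign J ((K.erase p).erase q) := by
  unfold shuffleSign
  rw [neg_one_pow_between, ← Finset.prod_mul_distrib]
  refine Finset.prod_congr rfl fun k hk => ?_
  rw [← Finset.mul_prod_erase K _ hp, ← Finset.mul_prod_erase (K.erase p) _ hq, ← mul_assoc]
  congr 1
  have h1 : k ≠ p := fun h => Finset.disjoint_left.1 hJK hk (h ▸ hp)
  have h2 : k ≠ q := fun h => Finset.disjoint_left.1 hJK hk (h ▸ Finset.mem_of_mem_erase hq)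
  rcases lt_or_gt_of_ne h1 with h1 | h1 <;> rcases lt_or_gt_of_ne h2 with h2 | h2 <;>
    simp [h1, h2, h1.not_gt, h2.not_gt]

/-- These are the terms in which the first row `p` belongs to `x`: expand `sPf x J` along `p` and
remove `p, q` from both `I` and `J`. The sign from `J` and the sign from the shuffle multiply to the
one for `I`. -/
theorem sum_powerset_expand_left {n : ℕ} (x y : Matrix (Fin n) (Fin n) ℂ) {I : Finset (Fin n)}
    {p : Fin n} (hp : p ∈ I) (hmin : ∀ i ∈ I, p ≤ i) :
    ∑ J ∈ I.powerset with p ∈ J, shuffleSign J (I \ J) * (sPf x J * sPf y (I \ J)) =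
      ∑ q ∈ I.erase p, (-1) ^ between pos I p q * (x p q *
        ∑ J ∈ ((I.erase p).erase q).powerset, shuffleSign J (((I.erase p).erase q) \ J) *
          (sPf x J * sPf y (((I.erase p).erase q) \ J))) := by
  simp only [Finset.mul_sum]
  have hL : ∀ J ∈ I.powerset.filter (fun J => p ∈ J),
      shuffleSign J (I \ J) * (sPf x J * sPf y (I \ J)) =
      ∑ q ∈ J.erase p, shuffleSign J (I \ J) * ((-1) ^ between pos J p q *
        (x p q * sPf x ((J.erase p).erase q)) * sPf y (I \ J)) := by
    intro J hJ
    simp only [Finset.mem_filter, Finset.mem_powerset] at hJ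
    rw [sPf_expand x hJ.2 (fun i hi => hmin i (hJ.1 hi)), Finset.sum_mul, Finset.mul_sum]
  rw [Finset.sum_congr rfl hL, Finset.sum_sigma', Finset.sum_sigma']
  refine Finset.sum_bij' (fun a _ => ⟨a.2, (a.1.erase p).erase a.2⟩)
    (fun b _ => ⟨insert p (insert b.1 b.2), b.1⟩) ?_ ?_ ?_ ?_ ?_
  · rintro ⟨J, q⟩ h
    simp only [Finset.mem_sigma, Finset.mem_filter, Finset.mem_powerset, Finset.mem_erase] at h ⊢
    refine ⟨⟨h.2.1, h.1.1 h.2.2⟩, ?_⟩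
    exact Finset.erase_subset_erase _ (Finset.erase_subset_erase _ h.1.1)
  · rintro ⟨q, J⟩ h
    simp only [Finset.mem_sigma, Finset.mem_filter, Finset.mem_powerset, Finset.mem_erase] at h ⊢
    refine ⟨⟨?_, by simp⟩, h.1.1, by simp⟩
    intro i hi
    simp only [Finset.mem_insert] at hi
    rcases hi with rfl | rfl | hi
    · exact hp
    · exact h.1.2
    · exact Finset.mem_of_mem_erase (Finset.mem_of_mem_erase (h.2 hi))
  · rintro ⟨J, q⟩ h
    simp only [Finset.mem_sigma, Finset.mem_filter, Finset.mem_powerset] at h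
    simp only [Sigma.mk.injEq, heq_eq_eq, and_true]
    rw [Finset.insert_erase h.2, Finset.insert_erase h.1.2]
  · rintro ⟨q, J⟩ h
    simp only [Finset.mem_sigma, Finset.mem_powerset, Finset.mem_erase] at h
    have hqJ : q ∉ J := fun h' => by simpa using h.2 h'
    have hpJ : p ∉ J := fun h' => by simpa using h.2 h'
    simp only [Sigma.mk.injEq, heq_eq_eq, true_and]
    rw [Finset.erase_insert (by simp [hpJ, h.1.1.symm]), Finset.erase_insert hqJ]
  · rintro ⟨J, q⟩ h
    simp only [Finset.mem_sigma, Finset.mem_filter, Finset.mem_powerset] at h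
    obtain ⟨⟨hJI, hpJ⟩, hq⟩ := h
    have hdiff : ((I.erase p).erase q) \ ((J.erase p).erase q) = I \ J := by
      ext i
      simp only [Finset.mem_sdiff, Finset.mem_erase] at hq ⊢
      grind
    have hI : J ∪ (I \ J) = I := Finset.union_sdiff_of_subset hJI
    have hdis : Disjoint J (I \ J) := Finset.disjoint_sdiff
    simp only
    rw [hdiff, shuffleSign_erase_left hpJ hq hdis]
    conv_rhs => rw [← hI, neg_one_pow_between_union hdis, hI]
    ring

theorem sum_powerset_expand_right {n : ℕ} (x y : Matrix (Fin n) (Fin n) ℂ) {I : Finset (Fin n)}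
    {p : Fin n} (hp : p ∈ I) (hmin : ∀ i ∈ I, p ≤ i) :
    ∑ J ∈ I.powerset with p ∉ J, shuffleSign J (I \ J) * (sPf x J * sPf y (I \ J)) =
      ∑ q ∈ I.erase p, (-1) ^ between pos I p q * (y p q *
        ∑ J ∈ ((I.erase p).erase q).powerset, shuffleSign J (((I.erase p).erase q) \ J) *
          (sPf x J * sPf y (((I.erase p).erase q) \ J))) := by
  simp only [Finset.mul_sum]
  have hL : ∀ J ∈ I.powerset.filter (fun J => p ∉ J),
      shuffleSign J (I \ J) * (sPf x J * sPf y (I \ J)) =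
      ∑ q ∈ (I \ J).erase p, shuffleSign J (I \ J) * (sPf x J * ((-1) ^ between pos (I \ J) p q *
        (y p q * sPf y (((I \ J).erase p).erase q)))) := by
    intro J hJ
    simp only [Finset.mem_filter, Finset.mem_powerset] at hJ
    rw [sPf_expand y (Finset.mem_sdiff.2 ⟨hp, hJ.2⟩)
      (fun i hi => hmin i (Finset.mem_sdiff.1 hi).1), Finset.mul_sum, Finset.mul_sum]
  rw [Finset.sum_congr rfl hL, Finset.sum_sigma', Finset.sum_sigma']
  refine Finset.sum_bij' (fun a _ => ⟨a.2, a.1⟩) (fun b _ => ⟨b.2, b.1⟩) ?_ ?_ ?_ ?_ ?_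
  · rintro ⟨J, q⟩ h
    simp only [Finset.mem_sigma, Finset.mem_filter, Finset.mem_powerset, Finset.mem_erase,
      Finset.mem_sdiff] at h ⊢
    refine ⟨⟨h.2.1, h.2.2.1⟩, fun i hi => ?_⟩
    simp only [Finset.mem_erase]
    exact ⟨fun h' => h.2.2.2 (h' ▸ hi), fun h' => h.1.2 (h' ▸ hi), h.1.1 hi⟩
  · rintro ⟨q, J⟩ h
    simp only [Finset.mem_sigma, Finset.mem_filter, Finset.mem_powerset, Finset.mem_erase,
      Finset.mem_sdiff] at h ⊢
    refine ⟨⟨fun i hi => Finset.mem_of_mem_erase (Finset.mem_of_mem_erase (h.2 hi)), ?_⟩,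
      h.1.1, h.1.2, ?_⟩
    · intro h'; simpa using h.2 h'
    · intro h'; simpa using h.2 h'
  · rintro ⟨J, q⟩ _
    rfl
  · rintro ⟨q, J⟩ _
    rfl
  · rintro ⟨J, q⟩ h
    simp only [Finset.mem_sigma, Finset.mem_filter, Finset.mem_powerset] at h
    obtain ⟨⟨hJI, hpJ⟩, hq⟩ := h
    have hdiff : ((I.erase p).erase q) \ J = ((I \ J).erase p).erase q := by
      ext i
      simp only [Finset.mem_sdiff, Finset.mem_erase]
      tauto
    have hI : J ∪ (I \ J) = I := Finset.union_sdiff_of_subset hJI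
    have hdis : Disjoint J (I \ J) := Finset.disjoint_sdiff
    simp only
    rw [hdiff, shuffleSign_erase_right (Finset.mem_sdiff.2 ⟨hp, hpJ⟩) hq hdis]
    conv_rhs => rw [← hI, neg_one_pow_between_union hdis, hI]
    ring

/-- The right side satisfies the first-row recurrence of `x + y`: subsets containing `p` give the
part with `x p q`, the others the part with `y p q`. -/
theorem sPf_add {n : ℕ} (x y : Matrix (Fin n) (Fin n) ℂ) (I : Finset (Fin n)) :
    sPf (x + y) I =
      ∑ J ∈ I.powerset, shuffleSign J (I \ J) * (sPf x J * sPf y (I \ J)) := by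
  symm
  refine congrFun (eq_sPf_of_expand (x + y)
    (fun I => ∑ J ∈ I.powerset, shuffleSign J (I \ J) * (sPf x J * sPf y (I \ J))) ?_ ?_) I
  · simp [shuffleSign, sPf_empty]
  · intro I p hp hmin
    rw [← Finset.sum_filter_add_sum_filter_not I.powerset (fun J => p ∈ J),
      sum_powerset_expand_left x y hp hmin, sum_powerset_expand_right x y hp hmin,
      ← Finset.sum_add_distrib]
    refine Finset.sum_congr rfl fun q _ => ?_
    rw [Matrix.add_apply]
    ring

/-- When `p` leaves `J`, the pairs of `p` with smaller elements of `Jᶜ` are lost and those with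
larger elements of `J` are gained. Modulo 2 their total is the number of all elements below `p` plus
the size of `J.erase p`. -/
theorem shuffleSign_compl_erase {n : ℕ} {J : Finset (Fin n)} {p : Fin n} (hp : p ∈ J) :
    shuffleSign J Jᶜ =
      (-1) ^ ((p : ℕ) + (J.erase p).card) * shuffleSign (J.erase p) (J.erase p)ᶜ := by
  have hc : (J.erase p)ᶜ = insert p Jᶜ := by
    ext i; simp only [Finset.mem_compl, Finset.mem_erase, Finset.mem_insert]; tauto
  unfold shuffleSign
  rw [hc, ← Finset.mul_prod_erase J _ hp]
  simp only [Finset.prod_insert (show p ∉ Jᶜ by simpa using hp)]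
  rw [Finset.prod_mul_distrib, ← mul_assoc]
  congr 1
  have h1 : ∏ j ∈ J.erase p, (if p < j then (-1 : ℂ) else 1) =
      (-1) ^ (J.erase p).card * ∏ j ∈ J.erase p, (if j < p then (-1 : ℂ) else 1) := by
    rw [← Finset.prod_const, ← Finset.prod_mul_distrib]
    refine Finset.prod_congr rfl fun j hj => ?_
    rcases lt_or_gt_of_ne (Finset.ne_of_mem_erase hj) with h | h <;> simp [h, h.not_gt]
  have h2 : (-1 : ℂ) ^ (p : ℕ) = (∏ k ∈ Jᶜ, if k < p then (-1 : ℂ) else 1) *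
      ∏ j ∈ J.erase p, (if j < p then (-1 : ℂ) else 1) := by
    have h3 : ∏ j ∈ J.erase p, (if j < p then (-1 : ℂ) else 1) =
        ∏ j ∈ J, (if j < p then (-1 : ℂ) else 1) := by
      rw [← Finset.mul_prod_erase J _ hp]; simp
    rw [h3, mul_comm, Finset.prod_mul_prod_compl, Finset.prod_ite, Finset.prod_const,
      Finset.prod_const_one, mul_one]
    congr 1
    rw [← Fin.card_Iio]
    congr 1
    ext i; simp
  rw [h1, pow_add, h2]
  have h4 : (∏ j ∈ J.erase p, (if j < p then (-1 : ℂ) else 1)) *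
      ∏ j ∈ J.erase p, (if j < p then (-1 : ℂ) else 1) = 1 := by
    rw [← Finset.prod_mul_distrib]
    exact Finset.prod_eq_one fun j _ => by split_ifs <;> norm_num
  have h5 := neg_one_pow_mul_self (J.erase p).card
  linear_combination -(∏ k ∈ Jᶜ, if k < p then (-1 : ℂ) else 1) *
    (h4 + (∏ j ∈ J.erase p, (if j < p then (-1 : ℂ) else 1)) ^ 2 * h5)

/-- Removing `p` and then `q` from `J` changes the shuffle sign by `(-1) ^ (p + q + 1)`, which is
the sign built into `tilde`. -/
theorem shuffleSign_mul_sPf_tilde {n : ℕ} (z : Matrix (Fin n) (Fin n) ℂ) (J : Finset (Fin n)) :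
    shuffleSign J Jᶜ * sPf (tilde z) J = sPf z J := by
  refine congrFun (eq_sPf_of_expand z (fun J => shuffleSign J Jᶜ * sPf (tilde z) J) ?_ ?_) J
  · simp [shuffleSign, sPf_empty]
  · intro J p hp hmin
    rw [sPf_expand _ hp hmin, Finset.mul_sum]
    refine Finset.sum_congr rfl fun q hq => ?_
    rw [shuffleSign_compl_erase hp, shuffleSign_compl_erase hq, tilde,
      ← Finset.card_erase_add_one hq]
    have hsign : (-1 : ℂ) ^ ((p : ℕ) + (((J.erase p).erase q).card + 1)) *
        (-1) ^ ((q : ℕ) + ((J.erase p).erase q).card) * (-1) ^ ((p : ℕ) + q + 1) = 1 := by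
      rw [← pow_add, ← pow_add]
      exact Even.neg_one_pow ⟨p + q + ((J.erase p).erase q).card + 1, by ring⟩
    linear_combination ((-1) ^ between pos J p q * (z p q *
      (shuffleSign ((J.erase p).erase q) ((J.erase p).erase q)ᶜ *
        sPf (tilde z) ((J.erase p).erase q)))) * hsign

/-- The Pfaffian of `z̃ + y` is the pairing of the vectors of sub-Pfaffians. -/
theorem pfaffian_tilde_add {n : ℕ} (z y : Matrix (Fin n) (Fin n) ℂ) :
    pfaffian (tilde z + y) = ∑ J : Finset (Fin n), sPf z J * sPfDual y J := by
  rw [pfaffian_eq_sPf_univ, sPf_add, Finset.powerset_univ]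
  refine Finset.sum_congr rfl fun J _ => ?_
  rw [← Finset.compl_eq_univ_sdiff, ← mul_assoc, shuffleSign_mul_sPf_tilde, sPfDual]

/-- A skew-symmetric matrix is determined by its `2 × 2` sub-Pfaffians. -/
theorem skewOf_sPf {n : ℕ} {z : Matrix (Fin n) (Fin n) ℂ} (hz : z.transpose = -z) :
    skewOf (sPf z) = z := by
  have hzs : ∀ i j, z j i = - z i j := fun i j => congrFun (congrFun hz i) j
  have key : ∀ i j, i < j → sPf z {i, j} = z i j := by
    intro i j hij
    rw [sPf_expand z (p := i) (by simp) (by simp [hij.le])]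
    have h1 : ({i, j} : Finset (Fin n)).erase i = {j} := by
      ext k; simp only [Finset.mem_erase, Finset.mem_insert, Finset.mem_singleton]
      constructor
      · tauto
      · rintro rfl; exact ⟨hij.ne', Or.inr rfl⟩
    have h2 : between pos ({i, j} : Finset (Fin n)) i j = 0 := by
      simp only [between, Finset.card_eq_zero, Finset.filter_eq_empty_iff]
      intro k hk
      simp only [Finset.mem_insert, Finset.mem_singleton] at hk
      rcases hk with rfl | rfl <;> simp
    rw [h1, Finset.sum_singleton, h2, Finset.erase_singleton, sPf_empty]
    simp
  ext i j
  unfold skewOf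
  split_ifs with h1 h2
  · exact key i j h1
  · rw [Finset.pair_comm, key j i h2, hzs j i]
  · have : i = j := le_antisymm (not_lt.1 h2) (not_lt.1 h1)
    subst this
    have := hzs i i
    linear_combination -(1 / 2 : ℂ) * this

theorem skewOf_transpose {n : ℕ} (w : Finset (Fin n) → ℂ) :
    (skewOf w).transpose = -skewOf w := by
  ext i j
  simp only [Matrix.transpose_apply, Matrix.neg_apply, skewOf, Finset.pair_comm j i]
  rcases lt_trichotomy i j with h | rfl | h
  · simp [h, h.not_gt]
  · simp
  · simp [h, h.not_gt]

/-! ### The value of a formulation -/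

/-- The stars partition the edges, so an index on every star is the same as an index on `E`. -/
theorem prod_sum_star {E W : Type*} [Fintype E] [DecidableEq E] [Fintype W] [DecidableEq W]
    (f : E → W) (F : ∀ w, (Star f w → Fin 2) → ℂ) :
    ∏ w, ∑ δ : Star f w → Fin 2, F w δ = ∑ δ : E → Fin 2, ∏ w, F w fun e => δ e.1 := by
  rw [Finset.prod_univ_sum, Fintype.piFinset_univ]
  refine Finset.sum_bij' (fun p _ e => p (f e) ⟨e, rfl⟩) (fun δ _ w e => δ e.1)
    (fun _ _ => Finset.mem_univ _) (fun _ _ => Finset.mem_univ _) ?_ (fun _ _ => rfl) ?_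
  · intro p _
    funext w e
    obtain ⟨e, rfl⟩ := e
    rfl
  · intro p _
    refine Finset.prod_congr rfl fun w _ => congrArg _ ?_
    funext e
    obtain ⟨e, rfl⟩ := e
    rfl

namespace Formulation

variable {V U E : Type*} [Fintype V] [Fintype U] [Fintype E]
  [DecidableEq V] [DecidableEq U] [DecidableEq E]

/-! ### Independence of the basis -/

theorem prod_G_rebase {V U E : Type*} [Fintype V] [Fintype E] [DecidableEq V] [DecidableEq U]
    [DecidableEq E] (Φ : Formulation V U E) (M : GL (Fin 2) ℂ) (ε : E → Fin 2) :
    ∏ v, (Φ.rebase M).G v (fun e => ε e.1) =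
      ∑ δ : E → Fin 2, (∏ e, (M⁻¹ : GL (Fin 2) ℂ).val (ε e) (δ e)) *
        ∏ v, Φ.G v fun e => δ e.1 := by
  change ∏ v, ∑ δ : Star Φ.left v → Fin 2, _ = _
  rw [prod_sum_star]
  refine Finset.sum_congr rfl fun δ _ => ?_
  rw [Finset.prod_mul_distrib]
  congr 1
  exact Fintype.prod_fiberwise Φ.left fun e => (M⁻¹ : GL (Fin 2) ℂ).val (ε e) (δ e)

theorem prod_R_rebase {V U E : Type*} [Fintype U] [Fintype E] [DecidableEq V] [DecidableEq U]
    [DecidableEq E] (Φ : Formulation V U E) (M : GL (Fin 2) ℂ) (ε : E → Fin 2) :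
    ∏ u, (Φ.rebase M).R u (fun e => ε e.1) =
      ∑ γ : E → Fin 2, (∏ e, M.val (γ e) (ε e)) * ∏ u, Φ.R u fun e => γ e.1 := by
  change ∏ u, ∑ γ : Star Φ.right u → Fin 2, _ = _
  rw [prod_sum_star]
  refine Finset.sum_congr rfl fun γ _ => ?_
  rw [Finset.prod_mul_distrib]
  congr 1
  exact Fintype.prod_fiberwise Φ.right fun e => M.val (γ e) (ε e)

theorem sum_prod_inv_mul (M : GL (Fin 2) ℂ) (γ δ : E → Fin 2) :
    ∑ ε : E → Fin 2, (∏ e, (M⁻¹ : GL (Fin 2) ℂ).val (ε e) (δ e)) * ∏ e, M.val (γ e) (ε e) =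
      if γ = δ then 1 else 0 := by
  have h1 : ∀ e, ∑ i : Fin 2, (M⁻¹ : GL (Fin 2) ℂ).val i (δ e) * M.val (γ e) i =
      if γ e = δ e then 1 else 0 := by
    intro e
    have h : M.val * (M⁻¹ : GL (Fin 2) ℂ).val = 1 := M.mul_inv
    have h2 := congrFun (congrFun h (γ e)) (δ e)
    rw [Matrix.mul_apply, Matrix.one_apply] at h2
    rw [← h2]
    exact Finset.sum_congr rfl fun i _ => mul_comm _ _
  have h3 := Finset.prod_univ_sum (fun _ : E => (Finset.univ : Finset (Fin 2)))
    (fun e i => (M⁻¹ : GL (Fin 2) ℂ).val i (δ e) * M.val (γ e) i)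
  rw [Fintype.piFinset_univ] at h3
  simp only [← Finset.prod_mul_distrib]
  rw [← h3]
  simp only [h1]
  split_ifs with h
  · exact Finset.prod_eq_one fun e _ => by simp [h]
  · obtain ⟨e, he⟩ := Function.ne_iff.1 h
    exact Finset.prod_eq_zero (Finset.mem_univ e) (by simp [he])

/-- The value of a formulation does not depend on the basis. -/
theorem pairing_rebase (Φ : Formulation V U E) (M : GL (Fin 2) ℂ) :
    (Φ.rebase M).pairing = Φ.pairing := by
  unfold pairing
  simp only [prod_G_rebase, prod_R_rebase, Finset.sum_mul_sum]
  rw [Finset.sum_comm]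
  refine Finset.sum_congr rfl fun δ _ => ?_
  rw [Finset.sum_comm]
  have h : ∀ γ : E → Fin 2, ∑ ε : E → Fin 2,
      ((∏ e, (M⁻¹ : GL (Fin 2) ℂ).val (ε e) (δ e)) * ∏ v, Φ.G v fun e => δ e.1) *
        ((∏ e, M.val (γ e) (ε e)) * ∏ u, Φ.R u fun e => γ e.1) =
      (if γ = δ then 1 else 0) *
        ((∏ v, Φ.G v fun e => δ e.1) * ∏ u, Φ.R u fun e => γ e.1) := by
    intro γ
    rw [← sum_prod_inv_mul M, Finset.sum_mul]
    refine Finset.sum_congr rfl fun ε _ => ?_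
    ring
  simp only [h, ite_mul, one_mul, zero_mul]
  rw [Finset.sum_ite_eq' Finset.univ δ]
  simp

theorem sum_slots {n : ℕ} (o : E ≃ Fin n) (F : (E → Fin 2) → ℂ) :
    ∑ ε : E → Fin 2, F ε = ∑ J : Finset (Fin n), F (slots o J) := by
  symm
  refine Finset.sum_bij' (fun J _ => slots o J)
    (fun ε _ => Finset.univ.filter fun i => ε (o.symm i) = 1)
    (fun _ _ => Finset.mem_univ _) (fun _ _ => Finset.mem_univ _) ?_ ?_ (fun _ _ => rfl)
  · intro J _
    ext i
    simp [slots]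
  · intro ε _
    funext e
    simp only [slots, Finset.mem_filter, Finset.mem_univ, true_and, Equiv.symm_apply_apply]
    split_ifs with h
    · exact h.symm
    · omega

/-- In a valid order, the value of a formulation is a Pfaffian. -/
theorem pairing_eq_pfaffian {V U E : Type*} [Fintype V] [Fintype U] [Fintype E] [DecidableEq E]
    (Φ : Formulation V U E) (hα : Φ.alpha ≠ 0) (hβ : Φ.beta ≠ 0)
    {o : E ≃ Fin (Fintype.card E)} (ho : Φ.IsValidOrder o) :
    Φ.pairing = Φ.alpha * Φ.beta * pfaffian (tilde (Φ.xMatrix o) + Φ.yMatrix o) := by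
  obtain ⟨z, y, hz, hy, hG, hR⟩ := ho
  have hx : Φ.xMatrix o = z := by rw [xMatrix, hG, skewOf_sPf hz]
  have hcovec : Φ.normR.covec o = sPf y := by
    funext I
    have h := congrFun hR Iᶜ
    rw [sPfDual, compl_compl] at h
    exact h
  have hy' : Φ.yMatrix o = y := by rw [yMatrix, hcovec, skewOf_sPf hy]
  rw [hx, hy', pfaffian_tilde_add, ← hG, ← hR, Finset.mul_sum, pairing, sum_slots o]
  refine Finset.sum_congr rfl fun J _ => ?_
  simp only [Signature.vec, normG, normR]
  field_simp

end Formulation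

theorem SatProblem.pairing_formulation {V U E : Type*} [Fintype V] [Fintype U] [Fintype E]
    [DecidableEq V] [DecidableEq U] [DecidableEq E] (P : SatProblem V U E) :
    P.formulation.pairing = P.numSat := by
  classical
  unfold Formulation.pairing
  -- Writing this as a sum over assignments also treats a variable in no clause: its generator is
  -- the scalar `1 + 1`, which counts both of its values.
  have hG : ∀ ε : E → Fin 2, ∏ v, P.formulation.G v (fun e => ε e.1) =
      ∑ a : V → Fin 2, if ε = fun e => a (P.left e) then (1 : ℂ) else 0 := by
    intro ε
    have h1 : ∀ v, P.formulation.G v (fun e => ε e.1) =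
        ∑ b : Fin 2, if ∀ e : Star P.left v, ε e.1 = b then (1 : ℂ) else 0 := by
      intro v
      rw [Fin.sum_univ_two]
      simp only [formulation]
      congr
    simp only [h1]
    rw [Finset.prod_univ_sum, Fintype.piFinset_univ]
    refine Finset.sum_congr rfl fun a _ => ?_
    split_ifs with h
    · refine Finset.prod_eq_one fun v _ => if_pos ?_
      rintro ⟨e, rfl⟩
      exact congrFun h e
    · obtain ⟨e, he⟩ := Function.ne_iff.1 h
      refine Finset.prod_eq_zero (Finset.mem_univ (P.left e)) (if_neg fun h' => ?_)
      exact he (h' ⟨e, rfl⟩)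
  have hR : ∀ ε : E → Fin 2, ∏ u, P.formulation.R u (fun e => ε e.1) =
      if ∀ u, P.clause u fun e => ε e.1 then (1 : ℂ) else 0 := by
    intro ε
    simp only [formulation]
    rw [Finset.prod_ite_zero]
    simp
  simp only [hG, hR, Finset.sum_mul]
  rw [Finset.sum_comm]
  simp only [ite_mul, one_mul, zero_mul, Finset.sum_ite_eq', Finset.mem_univ, if_true]
  rw [numSat, Nat.card_eq_fintype_card, Fintype.card_subtype, Finset.sum_boole]

end Holographic

namespace Holographic

open Equiv Equiv.Perm

/-! ### Noncrossing permutations -/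

/-- Going up from `a`, cyclically, one meets `b` strictly before `c`. -/
def Cyc (a b c : ℤ) : Prop := a < b ∧ b < c ∨ b < c ∧ c < a ∨ c < a ∧ a < b

/-- A permutation is noncrossing, for the cyclic order given by `f`, if every open arc from a point
to its image is invariant. -/
def Noncrossing {E : Type*} (f : E → ℤ) (σ : Perm E) : Prop :=
  ∀ x y, Cyc (f x) (f y) (f (σ x)) → Cyc (f x) (f (σ y)) (f (σ x))

theorem Cyc.of_not {a b c d : ℤ} (h : Cyc a b c) (h' : ¬ Cyc a b d) (hd : d ≠ a) :
    Cyc a d c := by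
  unfold Cyc at *; omega

theorem Cyc.trans {a b c d : ℤ} (h : Cyc a b c) (h' : Cyc a c d) : Cyc a b d := by
  unfold Cyc at *; omega

theorem Cyc.of_not_of_not {a b c d : ℤ} (h : Cyc a b c) (h1 : ¬ Cyc c a d) (h2 : ¬ Cyc c b d)
    (n1 : d ≠ a) (n2 : d ≠ b) (n3 : d ≠ c) : Cyc a b d := by
  unfold Cyc at *; omega

theorem Cyc.rotate {a b c : ℤ} (h : Cyc a b c) : Cyc b c a := by
  unfold Cyc at *; omega

theorem not_cyc_iff {a b c : ℤ} (h1 : a ≠ b) (h2 : b ≠ c) (h3 : a ≠ c) :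
    ¬ Cyc a b c ↔ Cyc a c b := by
  unfold Cyc at *; omega

theorem not_cyc_self_left (a b : ℤ) : ¬ Cyc a a b := by
  unfold Cyc at *; omega

theorem not_cyc_self_right (a b : ℤ) : ¬ Cyc a b b := by
  unfold Cyc at *; omega

theorem cyc_neg {a b c : ℤ} : Cyc (-a) (-b) (-c) ↔ Cyc c b a := by
  unfold Cyc at *; omega

section

variable {E : Type*} [Finite E]

theorem rel_of_sameCycle {σ : Perm E} (r : Setoid E) (h : ∀ x, r x (σ x)) {x y : E}
    (hxy : SameCycle σ x y) : r x y := by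
  obtain ⟨i, rfl⟩ := hxy.exists_nat_pow_eq
  induction i with
  | zero => exact r.refl _
  | succ i ih => rw [pow_succ', Perm.mul_apply]; exact r.trans (ih ⟨i, by simp⟩) (h _)

theorem Noncrossing.sameCycle {f : E → ℤ} {σ : Perm E} (h : Noncrossing f σ) {x y z : E}
    (hyz : SameCycle σ y z) (hy : Cyc (f x) (f y) (f (σ x))) : Cyc (f x) (f z) (f (σ x)) := by
  obtain ⟨i, rfl⟩ := hyz.exists_nat_pow_eq
  clear hyz
  induction i with
  | zero => exact hy
  | succ i ih => rw [pow_succ', Perm.mul_apply]; exact h _ _ ih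

/-- The open arc from a point to its image misses the cycle of the point. -/
theorem Noncrossing.not_cyc {f : E → ℤ} {σ : Perm E} (h : Noncrossing f σ) {x y : E}
    (hxy : SameCycle σ x y) : ¬ Cyc (f x) (f y) (f (σ x)) := by
  intro hy
  exact not_cyc_self_left _ _ (h.sameCycle hxy.symm hy)

/-- The arc from `σ w` to `w` in the reversed order is the arc from `w` to `σ w` in the original
one. -/
theorem Noncrossing.neg_inv {f : E → ℤ} {σ : Perm E} (h : Noncrossing f σ) :
    Noncrossing (-f) σ⁻¹ := by
  intro x y hy
  obtain ⟨w, rfl⟩ := σ.surjective x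
  have hw : σ⁻¹ (σ w) = w := σ.symm_apply_apply w
  simp only [hw, Pi.neg_apply, cyc_neg] at hy ⊢
  exact h.sameCycle (sameCycle_symm_apply_right.2 (SameCycle.refl σ y)) hy

variable [DecidableEq E]

/-- The new arc from `a` to `σ b` consists of the arc from `a` to `b`, the point `b` and the old arc
from `b` to `σ b`. The last is invariant under `σ`. A step `y` to `σ y` cannot leave the first
beyond `b`, since its arc would contain `b` and hence the whole cycle, including `a`. -/
theorem Noncrossing.mul_swap_left {f : E → ℤ} {σ : Perm E} (h : Noncrossing f σ)
    (hf : Function.Injective f) {a b : E} (hab : a ≠ b) (hs : SameCycle σ a b) (y : E)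
    (hy : Cyc (f a) (f y) (f (σ b))) :
    Cyc (f a) (f ((σ * swap a b) y)) (f (σ b)) := by
  have haa : f (σ a) ≠ f a := fun h' => hab (SameCycle.eq_of_left hs (hf h'))
  have hbb : f (σ b) ≠ f b := fun h' => hab (SameCycle.eq_of_right hs (hf h'))
  have hab' : f a ≠ f b := fun h' => hab (hf h')
  have h3 : ¬ Cyc (f b) (f a) (f (σ b)) := h.not_cyc hs.symm
  have hbσ : f a ≠ f (σ b) := by
    intro h'; rw [h'] at hy; unfold Cyc at hy; omega
  have hb : Cyc (f a) (f b) (f (σ b)) :=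
    (((not_cyc_iff hab'.symm hbσ hbb.symm).1 h3).rotate).rotate
  by_cases hya : y = a
  · subst hya; exact absurd hy (not_cyc_self_left _ _)
  by_cases hyb : y = b
  · subst hyb
    rw [Perm.mul_apply, swap_apply_right]
    exact hy.of_not (h.not_cyc hs) haa
  · rw [Perm.mul_apply, swap_apply_of_ne_of_ne hya hyb]
    have k1 : f y ≠ f a := fun h' => hya (hf h')
    have k2 : f y ≠ f b := fun h' => hyb (hf h')
    by_cases k6 : Cyc (f b) (f y) (f (σ b))
    · have k7 := h b y k6
      clear hy k6 h3
      unfold Cyc at *; omega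
    · have hay : Cyc (f a) (f y) (f b) := by
        clear h3
        unfold Cyc at *; omega
      by_cases hne : σ y = y
      · rw [hne]; exact hy
      have hne' : f (σ y) ≠ f y := fun h' => hne (hf h')
      by_cases k : f (σ y) = f b
      · rw [k]; exact hb
      refine Cyc.trans ?_ hb
      by_cases k5 : Cyc (f y) (f b) (f (σ y))
      · have k8 := h.sameCycle hs.symm k5
        clear h3 hb hy k6
        unfold Cyc at *; omega
      · clear h3 hb hy k6
        unfold Cyc at *; omega

/-- Splitting a cycle preserves being noncrossing. -/
theorem Noncrossing.mul_swap {f : E → ℤ} {σ : Perm E} (h : Noncrossing f σ)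
    (hf : Function.Injective f) {a b : E} (hab : a ≠ b) (hs : SameCycle σ a b) :
    Noncrossing f (σ * swap a b) := by
  intro x y hy
  by_cases hxa : x = a
  · subst hxa
    have hx : (σ * swap x b) x = σ b := by simp
    rw [hx] at hy ⊢
    exact h.mul_swap_left hf hab hs y hy
  by_cases hxb : x = b
  · subst hxb
    have hx : (σ * swap a x) x = σ a := by simp
    rw [hx] at hy ⊢
    rw [swap_comm]
    exact h.mul_swap_left hf hab.symm hs.symm y hy
  have hx : (σ * swap a b) x = σ x := by
    rw [Perm.mul_apply, swap_apply_of_ne_of_ne hxa hxb]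
  rw [hx] at hy ⊢
  by_cases hya : y = a
  · subst hya
    rw [Perm.mul_apply, swap_apply_left]
    exact h.sameCycle (sameCycle_apply_right.2 hs) hy
  by_cases hyb : y = b
  · subst hyb
    rw [Perm.mul_apply, swap_apply_right]
    exact h.sameCycle (sameCycle_apply_right.2 hs.symm) hy
  · rw [Perm.mul_apply, swap_apply_of_ne_of_ne hya hyb]
    exact h x y hy

/-! ### Counting cycles -/

/-- The new permutation sends `a` to `σ b` and then follows the old cycle of `b`, which avoids `a`,
until it reaches `b`. -/
theorem sameCycle_mul_swap {σ : Perm E} {a b : E} (h : ¬ SameCycle σ a b) :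
    SameCycle (σ * swap a b) a b := by
  by_contra hn
  have key : ∀ k : ℕ, SameCycle (σ * swap a b) a ((σ ^ (k + 1)) b) := by
    intro k
    induction k with
    | zero =>
      have : (σ ^ (0 + 1)) b = (σ * swap a b) a := by simp
      rw [this, sameCycle_apply_right]
    | succ k ih =>
      have h1 : (σ ^ (k + 1)) b ≠ b := fun h' => hn (by rw [h'] at ih; exact ih)
      have h2 : (σ ^ (k + 1)) b ≠ a := by
        intro h'
        exact h (SameCycle.symm ⟨((k + 1 : ℕ) : ℤ), by rw [zpow_natCast]; exact h'⟩)
      have h3 : (σ ^ (k + 1 + 1)) b = (σ * swap a b) ((σ ^ (k + 1)) b) := by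
        rw [Perm.mul_apply, swap_apply_of_ne_of_ne h2 h1, pow_succ' σ (k + 1), Perm.mul_apply]
      rw [h3, sameCycle_apply_right]
      exact ih
  obtain ⟨m, hm, hm1⟩ := (isOfFinOrder_of_finite σ).exists_pow_eq_one
  obtain ⟨k, rfl⟩ := Nat.exists_eq_succ_of_ne_zero hm.ne'
  have := key k
  rw [Nat.succ_eq_add_one] at hm1
  rw [hm1] at this
  exact hn this

theorem sameCycle_mul_swap_of_sameCycle {σ : Perm E} {a b x y : E} (h : ¬ SameCycle σ a b)
    (hxy : SameCycle σ x y) : SameCycle (σ * swap a b) x y := by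
  have hab := sameCycle_mul_swap h
  refine rel_of_sameCycle (SameCycle.setoid (σ * swap a b)) (fun z => ?_) hxy
  change SameCycle _ _ _
  have h1 : σ z = (σ * swap a b) (swap a b z) := by simp
  rw [h1, sameCycle_apply_right]
  by_cases hza : z = a
  · subst hza; rwa [swap_apply_left]
  by_cases hzb : z = b
  · subst hzb; rw [swap_apply_right]; exact hab.symm
  · rw [swap_apply_of_ne_of_ne hza hzb]

theorem sameCycle_of_mul_swap {σ : Perm E} {a b x y : E}
    (hxy : SameCycle (σ * swap a b) x y) : SameCycle σ x y ∨
      (SameCycle σ x a ∨ SameCycle σ x b) ∧ (SameCycle σ y a ∨ SameCycle σ y b) := by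
  let r : Setoid E :=
    { r := fun x y => SameCycle σ x y ∨
        (SameCycle σ x a ∨ SameCycle σ x b) ∧ (SameCycle σ y a ∨ SameCycle σ y b)
      iseqv := by
        refine ⟨fun x => Or.inl (SameCycle.refl _ _), ?_, ?_⟩
        · rintro x y (h | h)
          · exact Or.inl h.symm
          · exact Or.inr ⟨h.2, h.1⟩
        · rintro x y z (h | h) (h' | h')
          · exact Or.inl (h.trans h')
          · exact Or.inr ⟨h'.1.imp h.trans h.trans, h'.2⟩
          · exact Or.inr ⟨h.1, h.2.imp h'.symm.trans h'.symm.trans⟩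
          · exact Or.inr ⟨h.1, h'.2⟩ }
  refine rel_of_sameCycle r (fun z => ?_) hxy
  change SameCycle σ _ _ ∨ _
  simp only [Perm.mul_apply, sameCycle_apply_right, sameCycle_apply_left]
  by_cases hza : z = a
  · subst hza
    rw [swap_apply_left]
    exact Or.inr ⟨Or.inl (SameCycle.refl _ _), Or.inr (SameCycle.refl _ _)⟩
  by_cases hzb : z = b
  · subst hzb
    rw [swap_apply_right]
    exact Or.inr ⟨Or.inr (SameCycle.refl _ _), Or.inl (SameCycle.refl _ _)⟩
  · rw [swap_apply_of_ne_of_ne hza hzb]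
    exact Or.inl (SameCycle.refl _ _)

/-- Multiplication by a transposition that joins two cycles. -/
theorem numCycles_mul_swap {σ : Perm E} {a b : E} (h : ¬ SameCycle σ a b) :
    numCycles (σ * swap a b) + 1 = numCycles σ := by
  classical
  let s := SameCycle.setoid σ
  let r := SameCycle.setoid (σ * swap a b)
  -- The joined cycle is represented by the old cycle of `a`; with the cycle of `b` left out, the
  -- map on cycles is bijective.
  let m : {c : Quotient s // c ≠ Quotient.mk s b} → Quotient r := fun c =>
    Quotient.map' (s₁ := s) (s₂ := r) id (fun _ _ hxy => sameCycle_mul_swap_of_sameCycle h hxy) c.1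
  have hm : Function.Bijective m := by
    constructor
    · rintro ⟨c, hc⟩ ⟨d, hd⟩ hcd
      induction c using Quotient.inductionOn with | h x => ?_
      induction d using Quotient.inductionOn with | h y => ?_
      have hxy : SameCycle (σ * swap a b) x y := Quotient.exact hcd
      have hx : ¬ SameCycle σ x b := fun h' => hc (Quotient.sound h')
      have hy : ¬ SameCycle σ y b := fun h' => hd (Quotient.sound h')
      apply Subtype.ext
      apply Quotient.sound
      rcases sameCycle_of_mul_swap hxy with h' | ⟨h1 | h1, h2 | h2⟩
      · exact h'
      · exact h1.trans h2.symm
      · exact absurd h2 hy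
      · exact absurd h1 hx
      · exact absurd h1 hx
    · intro c
      induction c using Quotient.inductionOn with | h x => ?_
      by_cases hx : SameCycle σ x b
      · refine ⟨⟨Quotient.mk s a, fun h' => h (Quotient.exact h')⟩, ?_⟩
        apply Quotient.sound
        exact (sameCycle_mul_swap h).trans (sameCycle_mul_swap_of_sameCycle h hx.symm)
      · exact ⟨⟨Quotient.mk s x, fun h' => hx (Quotient.exact h')⟩, rfl⟩
  unfold numCycles
  rw [← Nat.card_congr (Equiv.ofBijective m hm)]
  change _ = Nat.card (Quotient s)
  have : Fintype (Quotient s) := Fintype.ofFinite _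
  rw [Nat.card_eq_fintype_card, Nat.card_eq_fintype_card, Fintype.card_subtype_compl,
    Fintype.card_subtype_eq]
  have : 0 < Fintype.card (Quotient s) := Fintype.card_pos_iff.2 ⟨Quotient.mk s b⟩
  omega

theorem numCycles_mul_comm {E : Type*} (σ τ : Perm E) : numCycles (τ * σ) = numCycles (σ * τ) := by
  refine Nat.card_congr (Quotient.congr τ.symm fun x y => ?_)
  change SameCycle _ _ _ ↔ SameCycle _ _ _
  have h : τ * σ = τ * (σ * τ) * τ⁻¹ := by group
  rw [h, sameCycle_conj]
  rfl

theorem card_quotient_le {E : Type*} [Finite E] {r s : Setoid E} (h : ∀ x y, r x y → s x y) :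
    Nat.card (Quotient s) ≤ Nat.card (Quotient r) :=
  Nat.card_le_card_of_surjective (Quotient.map' (s₁ := r) (s₂ := s) id h)
    (fun c => by
      induction c using Quotient.inductionOn with | h x => exact ⟨Quotient.mk r x, rfl⟩)

theorem eq_one_of_card_le_numCycles {E : Type*} [Finite E] {σ : Perm E}
    (h : Nat.card E ≤ numCycles σ) : σ = 1 := by
  have hs : Function.Surjective (Quotient.mk (SameCycle.setoid σ)) := Quotient.mk_surjective
  have hb := (Nat.bijective_iff_surjective_and_card _).2
    ⟨hs, le_antisymm h (Nat.card_le_card_of_surjective _ hs)⟩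
  ext x
  refine hb.1 (Quotient.sound ?_)
  change SameCycle σ _ _
  exact sameCycle_apply_left.2 (SameCycle.refl σ x)

/-- The orbits of the group generated by two permutations. -/
abbrev orbitSetoid {E : Type*} (σ τ : Perm E) : Setoid E :=
  MulAction.orbitRel (Subgroup.closure ({σ, τ} : Set (Perm E))) E

theorem orbitSetoid_left {E : Type*} (σ τ : Perm E) (x : E) : orbitSetoid σ τ x (σ x) :=
  Setoid.symm' _ ⟨⟨σ, Subgroup.subset_closure (by simp)⟩, rfl⟩

theorem orbitSetoid_right {E : Type*} (σ τ : Perm E) (x : E) : orbitSetoid σ τ x (τ x) :=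
  Setoid.symm' _ ⟨⟨τ, Subgroup.subset_closure (by simp)⟩, rfl⟩

theorem rel_of_orbitSetoid {E : Type*} {σ τ : Perm E} (r : Setoid E) (hσ : ∀ x, r x (σ x))
    (hτ : ∀ x, r x (τ x)) {x y : E} (h : orbitSetoid σ τ x y) : r x y := by
  obtain ⟨⟨g, hg⟩, rfl⟩ := h
  change r (g y) y
  revert y
  induction hg using Subgroup.closure_induction with
  | mem g hg =>
    rcases hg with rfl | rfl
    · exact fun {y} => r.symm (hσ y)
    · exact fun {y} => r.symm (hτ y)
  | one => exact fun {y} => r.refl y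
  | mul g g' _ _ h h' => exact fun {y} => r.trans h h'
  | inv g _ h =>
    intro y
    have := h (y := g⁻¹ y)
    rw [show g (g⁻¹ y) = y from g.apply_symm_apply y] at this
    exact r.symm this

end

/-! ### Permutations of genus zero -/

section

variable {E : Type*} [Finite E] [DecidableEq E]

/-- Numbering the points along the single cycle makes every open arc from a point to its image
empty, also where the cycle closes. -/
theorem exists_noncrossing_of_sameCycle {σ : Perm E} (h : ∀ x y, SameCycle σ x y) :
    ∃ f : E → ℤ, Function.Injective f ∧ Noncrossing f σ := by
  classical
  rcases isEmpty_or_nonempty E with hE | ⟨⟨x₀⟩⟩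
  · exact ⟨fun _ => 0, fun x => hE.elim x, fun x => hE.elim x⟩
  have hex : ∀ x, ∃ k : ℕ, (σ ^ k) x₀ = x := fun x => (h x₀ x).exists_nat_pow_eq
  let d : E → ℕ := fun x => Nat.find (hex x)
  have hd : ∀ x, (σ ^ d x) x₀ = x := fun x => Nat.find_spec (hex x)
  have hmin : ∀ x k, (σ ^ k) x₀ = x → d x ≤ k := fun x k hk => Nat.find_min' (hex x) hk
  have hsucc : ∀ x, d (σ x) = d x + 1 ∨ d (σ x) = 0 ∧ ∀ y, d y ≤ d x := by
    intro x
    have h1 : (σ ^ (d x + 1)) x₀ = σ x := by rw [pow_succ', Perm.mul_apply, hd]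
    have h2 := hmin _ _ h1
    rcases Nat.eq_zero_or_pos (d (σ x)) with h0 | h0
    · right
      refine ⟨h0, fun y => ?_⟩
      have h3 : (σ ^ (d x + 1)) x₀ = x₀ := by
        have := hd (σ x)
        rw [h0] at this
        rw [h1]; exact this.symm
      have h4 : (σ ^ (d y % (d x + 1))) x₀ = y := by
        have h5 : (σ ^ ((d x + 1) * (d y / (d x + 1)))) x₀ = x₀ := by
          rw [pow_mul]
          exact Perm.pow_apply_eq_self_of_apply_eq_self h3 _
        conv_rhs => rw [← hd y, ← Nat.mod_add_div (d y) (d x + 1), pow_add, Perm.mul_apply, h5]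
      have h6 := hmin y _ h4
      have h7 : d y % (d x + 1) < d x + 1 := Nat.mod_lt (d y) (Nat.succ_pos (d x))
      omega
    · left
      obtain ⟨k, hk⟩ := Nat.exists_eq_succ_of_ne_zero h0.ne'
      have h3 : (σ ^ k) x₀ = x := by
        apply σ.injective
        rw [← Perm.mul_apply, ← pow_succ', ← Nat.succ_eq_add_one, ← hk, hd]
      have := hmin x k h3
      omega
  refine ⟨fun x => d x, ?_, ?_⟩
  · intro x y hxy
    have : d x = d y := Int.ofNat_inj.1 hxy
    rw [← hd x, ← hd y, this]
  · intro x y hy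
    exfalso
    simp only [Cyc] at hy
    rcases hsucc x with h1 | ⟨h1, h2⟩
    · omega
    · have := h2 y
      omega

/-- Join cycles until at most one is left, and then split them again. -/
theorem exists_noncrossing (σ : Perm E) :
    ∃ f : E → ℤ, Function.Injective f ∧ Noncrossing f σ := by
  induction hn : numCycles σ using Nat.strong_induction_on generalizing σ with
  | _ n ih =>
    by_cases h : ∀ x y, SameCycle σ x y
    · exact exists_noncrossing_of_sameCycle h
    · push Not at h
      obtain ⟨a, b, hab⟩ := h
      have h1 := numCycles_mul_swap hab
      obtain ⟨f, hf, hnc⟩ := ih _ (by omega) (σ * swap a b) rfl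
      refine ⟨f, hf, ?_⟩
      have := hnc.mul_swap hf (fun h' => hab (by rw [h'])) (sameCycle_mul_swap hab)
      rwa [mul_assoc, swap_mul_self, mul_one] at this

/-- The rotation system of two permutations has genus zero (the genus is never negative). -/
def GenusZero {E : Type*} (σ τ : Perm E) : Prop :=
  Nat.card E + 2 * Nat.card (Quotient (orbitSetoid σ τ)) ≤
    numCycles σ + numCycles τ + numCycles (σ * τ)

theorem GenusZero.symm {E : Type*} {σ τ : Perm E} (h : GenusZero σ τ) : GenusZero τ σ := by
  unfold GenusZero at *
  rw [numCycles_mul_comm σ τ]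
  have : Nat.card (Quotient (orbitSetoid τ σ)) = Nat.card (Quotient (orbitSetoid σ τ)) := by
    unfold orbitSetoid
    rw [Set.pair_comm]
  omega

/-- Two permutations are noncrossing for one cyclic order and its reverse. -/
def HasNoncrossingOrder {E : Type*} (σ τ : Perm E) : Prop :=
  ∃ f : E → ℤ, Function.Injective f ∧ Noncrossing f σ ∧ Noncrossing (-f) τ

theorem HasNoncrossingOrder.symm {E : Type*} {σ τ : Perm E} (h : HasNoncrossingOrder σ τ) :
    HasNoncrossingOrder τ σ := by
  obtain ⟨f, hf, h1, h2⟩ := h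
  exact ⟨-f, fun x y hxy => hf (neg_injective hxy), h2, by rwa [neg_neg]⟩

/-- Joining two vertices that lie on a common face. -/
theorem GenusZero.exists_join {σ τ : Perm E} (h : GenusZero σ τ) {c : E}
    (hc : ¬ SameCycle σ c (τ c)) :
    ∃ σ' : Perm E, numCycles σ' < numCycles σ ∧ GenusZero σ' τ ∧
      (HasNoncrossingOrder σ' τ → HasNoncrossingOrder σ τ) := by
  -- With this choice of the transposition, `σ * swap (σ⁻¹ c) (τ c) * τ` fixes `c`: the face through
  -- `c` is cut and `c` becomes a face of its own.
  have hab : ¬ SameCycle σ (σ⁻¹ c) (τ c) := fun h' => hc (sameCycle_symm_apply_left.1 h')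
  have hne : σ⁻¹ c ≠ τ c := fun h' => hab (h' ▸ SameCycle.refl _ _)
  have h1 := numCycles_mul_swap hab
  have hface : numCycles (σ * τ) + 1 = numCycles (σ * swap (σ⁻¹ c) (τ c) * τ) := by
    have e1 : σ * swap (σ⁻¹ c) (τ c) * τ * swap (τ⁻¹ (σ⁻¹ c)) c = σ * τ := by
      have := swap_mul_eq_mul_swap τ (σ⁻¹ c) (τ c)
      rw [show τ⁻¹ (τ c) = c from τ.symm_apply_apply c] at this
      rw [mul_assoc σ, this, mul_assoc σ, mul_assoc τ, swap_mul_self, mul_one]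
    have hfix : (σ * swap (σ⁻¹ c) (τ c) * τ) c = c := by
      rw [Perm.mul_apply, Perm.mul_apply, swap_apply_right]
      exact σ.apply_symm_apply c
    have hns : ¬ SameCycle (σ * swap (σ⁻¹ c) (τ c) * τ) (τ⁻¹ (σ⁻¹ c)) c := by
      intro h'
      have h2 := SameCycle.eq_of_right h' hfix
      apply hne
      exact (τ.apply_symm_apply _).symm.trans (congrArg τ h2)
    have := numCycles_mul_swap hns
    rwa [e1] at this
  -- Joining vertices only merges orbits, so their number does not grow.
  have horb : Nat.card (Quotient (orbitSetoid (σ * swap (σ⁻¹ c) (τ c)) τ)) ≤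
      Nat.card (Quotient (orbitSetoid σ τ)) := by
    apply card_quotient_le
    intro x y hxy
    refine rel_of_orbitSetoid _ (fun z => ?_) (orbitSetoid_right _ τ) hxy
    exact rel_of_sameCycle _ (orbitSetoid_left _ τ)
      (sameCycle_mul_swap_of_sameCycle hab (sameCycle_apply_right.2 (SameCycle.refl σ z)))
  refine ⟨σ * swap (σ⁻¹ c) (τ c), by omega, ?_, ?_⟩
  · unfold GenusZero at *
    omega
  · rintro ⟨f, hf, hσ, hτ⟩
    refine ⟨f, hf, ?_, hτ⟩
    have := hσ.mul_swap hf hne (sameCycle_mul_swap hab)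
    rwa [mul_assoc, swap_mul_self, mul_one] at this

/-- A rotation system of genus zero has a closed curve that crosses every edge once and separates
the two classes of vertices. -/
theorem GenusZero.hasNoncrossingOrder {σ τ : Perm E} (h : GenusZero σ τ) :
    HasNoncrossingOrder σ τ := by
  induction hn : numCycles σ + numCycles τ using Nat.strong_induction_on generalizing σ τ with
  | _ n ih =>
    by_cases h1 : ∀ c, SameCycle σ c (τ c)
    · by_cases h2 : ∀ c, SameCycle τ c (σ c)
      -- No join is possible on either side: cycles of `σ`, cycles of `τ` and components coincide.
      -- Genus zero then leaves at least as many faces as edges, so every face is a fixed point.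
      · have k1 : numCycles σ ≤ Nat.card (Quotient (orbitSetoid σ τ)) :=
          card_quotient_le fun x y hxy => rel_of_orbitSetoid (SameCycle.setoid σ)
            (fun x => sameCycle_apply_right.2 (SameCycle.refl σ x)) h1 hxy
        have k2 : numCycles τ ≤ Nat.card (Quotient (orbitSetoid σ τ)) :=
          card_quotient_le fun x y hxy => rel_of_orbitSetoid (SameCycle.setoid τ)
            h2 (fun x => sameCycle_apply_right.2 (SameCycle.refl τ x)) hxy
        have k3 : σ * τ = 1 := eq_one_of_card_le_numCycles (by unfold GenusZero at h; omega)
        obtain ⟨f, hf, hnc⟩ := exists_noncrossing σ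
        refine ⟨f, hf, hnc, ?_⟩
        rw [← inv_eq_of_mul_eq_one_right k3]
        exact hnc.neg_inv
      · push Not at h2
        obtain ⟨c, hc⟩ := h2
        obtain ⟨τ', k1, k2, k3⟩ := h.symm.exists_join hc
        exact (k3 (ih _ (by omega) k2.symm rfl).symm).symm
    · push Not at h1
      obtain ⟨c, hc⟩ := h1
      obtain ⟨σ', k1, k2, k3⟩ := h.exists_join hc
      exact k3 (ih _ (by omega) k2 rfl)

end

/-! ### Cyclic orders at the vertices -/

section

variable {E W : Type*} [Fintype E] [DecidableEq W] {l : E → W}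

/-- The position of an edge in the order of the edges at its end. -/
def localPos (o : LocalOrders l) (e : E) : ℤ := ((o (l e) ⟨e, rfl⟩ : ℕ) : ℤ)

theorem localPos_eq (o : LocalOrders l) {w : W} (e : Star l w) :
    localPos o e.1 = ((o w e : ℕ) : ℤ) := by
  obtain ⟨e, rfl⟩ := e
  rfl

theorem rotation_apply (o : LocalOrders l) {w : W} (e : Star l w) :
    rotation o e.1 = ((o w).symm (finRotate _ (o w e))).1 := by
  obtain ⟨e, rfl⟩ := e
  rfl

theorem rotation_symm_apply (o : LocalOrders l) {w : W} {k : ℕ}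
    (hk : k + 1 < Fintype.card (Star l w)) :
    rotation o ((o w).symm ⟨k, by omega⟩).1 = ((o w).symm ⟨k + 1, hk⟩).1 := by
  rw [rotation_apply, Equiv.apply_symm_apply]
  have key : ∀ (d k : ℕ) (hk : k + 1 < d), finRotate d ⟨k, by omega⟩ = ⟨k + 1, hk⟩ := by
    intro d k hk
    obtain ⟨d, rfl⟩ : ∃ d', d = d' + 1 := ⟨d - 1, by omega⟩
    exact finRotate_of_lt (by omega)
  rw [key _ _ hk]

theorem apply_rotation (o : LocalOrders l) (e : E) : l (rotation o e) = l e := by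
  rw [show rotation o e = _ from rotation_apply o (⟨e, rfl⟩ : Star l (l e))]
  exact ((o (l e)).symm _).2

theorem sameCycle_rotation_zero (o : LocalOrders l) {w : W} {k : ℕ}
    (hk : k < Fintype.card (Star l w)) :
    SameCycle (rotation o) ((o w).symm ⟨0, by omega⟩).1 ((o w).symm ⟨k, hk⟩).1 := by
  induction k with
  | zero => exact SameCycle.refl _ _
  | succ k ih =>
    rw [← rotation_symm_apply o hk, sameCycle_apply_right]
    exact ih (by omega)

theorem sameCycle_rotation (o : LocalOrders l) {x y : E} :
    SameCycle (rotation o) x y ↔ l x = l y := by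
  constructor
  · exact rel_of_sameCycle (Setoid.ker l) fun z => (apply_rotation o z).symm
  · intro h
    have h1 := sameCycle_rotation_zero o (o (l x) ⟨x, rfl⟩).2
    have h2 := sameCycle_rotation_zero o (o (l x) ⟨y, h.symm⟩).2
    simp only [Fin.eta, Equiv.symm_apply_apply] at h1 h2
    exact h1.symm.trans h2

/-- The blocks of a noncrossing permutation do not cross. -/
theorem Noncrossing.not_crossing {f : E → ℤ} (hf : Function.Injective f) {σ : Perm E}
    (h : Noncrossing f σ) {a b c d : E} (hab : SameCycle σ a b) (hcd : SameCycle σ c d)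
    (hac : ¬ SameCycle σ a c) (h1 : Cyc (f a) (f c) (f b)) : ¬ Cyc (f b) (f d) (f a) := by
  intro h2
  -- The cycle of `a` stays on one side of the chord from `c` to `d`: a step across it would have an
  -- arc containing just one of `c` and `d`.
  have key : ∀ k : ℕ, Cyc (f d) (f ((σ ^ k) a)) (f c) := by
    intro k
    induction k with
    | zero =>
      simp only [pow_zero, Perm.coe_one, id_eq]
      unfold Cyc at *; omega
    | succ k ih =>
      set x := (σ ^ k) a with hx
      have hσx : (σ ^ (k + 1)) a = σ x := by rw [pow_succ', Perm.mul_apply]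
      rw [hσx]
      have hax : SameCycle σ a (σ x) :=
        sameCycle_apply_right.2 ⟨(k : ℤ), by rw [zpow_natCast]⟩
      have n1 : f (σ x) ≠ f c := fun h' => hac (hf h' ▸ hax)
      have n2 : f (σ x) ≠ f d := fun h' => hac ((hf h' ▸ hax).trans hcd.symm)
      by_cases k1 : Cyc (f x) (f c) (f (σ x))
      · have k2 := h.sameCycle hcd k1
        unfold Cyc at *; omega
      · have k2 : ¬ Cyc (f x) (f d) (f (σ x)) := fun k2 => k1 (h.sameCycle hcd.symm k2)
        clear h1 h2
        unfold Cyc at *; omega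
  obtain ⟨k, rfl⟩ := hab.exists_nat_pow_eq
  have := key k
  unfold Cyc at *; omega

/-- The arc from one edge to the next at `w` contains no further edge at `w`, so the edges are met
in the order of their positions. -/
theorem Noncrossing.cyc_zero (o : LocalOrders l) {f : E → ℤ} (hf : Function.Injective f)
    (h : Noncrossing f (rotation o)) {w : W} {i j : ℕ} (hi : 0 < i) (hij : i < j)
    (hj : j < Fintype.card (Star l w)) :
    Cyc (f ((o w).symm ⟨0, by omega⟩).1) (f ((o w).symm ⟨i, by omega⟩).1)
      (f ((o w).symm ⟨j, hj⟩).1) := by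
  have hinj : ∀ {i j : ℕ} (hi : i < Fintype.card (Star l w)) (hj : j < Fintype.card (Star l w)),
      i ≠ j → f ((o w).symm ⟨i, hi⟩).1 ≠ f ((o w).symm ⟨j, hj⟩).1 := by
    intro i j hi hj hij h'
    have := (o w).symm.injective (Subtype.ext (hf h'))
    exact hij (by simpa using this)
  have hnot : ∀ {j k : ℕ} (hj : j + 1 < Fintype.card (Star l w))
      (hk : k < Fintype.card (Star l w)),
      ¬ Cyc (f ((o w).symm ⟨j, by omega⟩).1) (f ((o w).symm ⟨k, hk⟩).1)
        (f ((o w).symm ⟨j + 1, hj⟩).1) := by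
    intro j k hj hk
    rw [← rotation_symm_apply o hj]
    apply h.not_cyc
    rw [sameCycle_rotation]
    rw [((o w).symm _).2, ((o w).symm _).2]
  induction j with
  | zero => omega
  | succ j ih =>
    have e1 := hnot hj (k := 0) (by omega)
    have n1 := hinj (i := 0) (j := j + 1) (by omega) hj (by omega)
    have n2 := hinj (i := i) (j := j + 1) (by omega) hj (by omega)
    have n3 := hinj (i := 0) (j := i) (by omega) (by omega) (by omega)
    rcases Nat.lt_succ_iff_lt_or_eq.1 hij with h' | rfl
    · have k1 := ih h' (by omega) hnot
      have e2 := hnot hj (k := i) (by omega)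
      have n4 := hinj (i := j) (j := j + 1) (by omega) hj (by omega)
      exact k1.of_not_of_not e1 e2 n1.symm n2.symm n4.symm
    · exact ((not_cyc_iff n3.symm n1 n2).1 e1).rotate.rotate

theorem Noncrossing.cyc_of_localPos_lt (o : LocalOrders l) {f : E → ℤ}
    (hf : Function.Injective f) (h : Noncrossing f (rotation o)) {a b c : E} (hab : l a = l b)
    (hac : l a = l c) (h1 : localPos o a < localPos o b) (h2 : localPos o b < localPos o c) :
    Cyc (f a) (f b) (f c) := by
  have ea := localPos_eq o (⟨a, rfl⟩ : Star l (l a))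
  have eb := localPos_eq o (⟨b, hab.symm⟩ : Star l (l a))
  have ec := localPos_eq o (⟨c, hac.symm⟩ : Star l (l a))
  simp only at ea eb ec
  rw [ea, eb] at h1
  rw [eb, ec] at h2
  norm_cast at h1 h2
  have k2 := h.cyc_zero o hf (lt_of_le_of_lt (Nat.zero_le _) h1) h2
    (o (l a) ⟨c, hac.symm⟩).2
  simp only [Fin.eta, Equiv.symm_apply_apply] at k2
  rcases Nat.eq_zero_or_pos (o (l a) ⟨a, rfl⟩ : ℕ) with h0 | h0
  · have : (⟨0, by omega⟩ : Fin (Fintype.card (Star l (l a)))) = o (l a) ⟨a, rfl⟩ :=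
      Fin.ext h0.symm
    rw [this, Equiv.symm_apply_apply] at k2
    exact k2
  · have k1 := h.cyc_zero o hf h0 h1 (o (l a) ⟨b, hab.symm⟩).2
    simp only [Fin.eta, Equiv.symm_apply_apply] at k1
    unfold Cyc at *; omega

theorem localPos_ne (o : LocalOrders l) {a b : E} (hab : l a = l b) (hne : a ≠ b) :
    localPos o a ≠ localPos o b := by
  intro h
  have ea := localPos_eq o (⟨a, rfl⟩ : Star l (l a))
  have eb := localPos_eq o (⟨b, hab.symm⟩ : Star l (l a))
  simp only at ea eb
  rw [ea, eb] at h
  norm_cast at h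
  exact hne (congrArg Subtype.val ((o (l a)).injective (Fin.ext h)))

/-- A noncrossing permutation induces the given cyclic order on every block. -/
theorem Noncrossing.cyc_iff (o : LocalOrders l) {f : E → ℤ} (hf : Function.Injective f)
    (h : Noncrossing f (rotation o)) {a b c : E} (hab : l a = l b) (hac : l a = l c)
    (h1 : a ≠ b) (h2 : b ≠ c) (h3 : a ≠ c) :
    Cyc (f a) (f b) (f c) ↔ Cyc (localPos o a) (localPos o b) (localPos o c) := by
  have key : ∀ {a b c : E}, l a = l b → l a = l c →
      Cyc (localPos o a) (localPos o b) (localPos o c) → Cyc (f a) (f b) (f c) := by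
    intro a b c hab hac hc
    rcases hc with hc | hc | hc
    · exact h.cyc_of_localPos_lt o hf hab hac hc.1 hc.2
    · exact (h.cyc_of_localPos_lt o hf (hab.symm.trans hac) hab.symm hc.1 hc.2).rotate.rotate
    · exact (h.cyc_of_localPos_lt o hf hac.symm (hac.symm.trans hab) hc.1 hc.2).rotate
  refine ⟨fun hc => ?_, key hab hac⟩
  by_contra hn
  rw [not_cyc_iff (localPos_ne o hab h1) (localPos_ne o (hab.symm.trans hac) h2)
    (localPos_ne o hac h3)] at hn
  have := key hac hab hn
  unfold Cyc at *; omega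

end

end Holographic

namespace Holographic

/-! ### Grassmann–Plücker vectors -/

theorem symmDiff_singleton_erase {d : ℕ} {I : Finset (Fin d)} {p : Fin d} (hp : p ∈ I) :
    symmDiff {p} (I.erase p) = I := by
  ext i
  simp only [Finset.mem_symmDiff, Finset.mem_singleton, Finset.mem_erase]
  by_cases h : i = p
  · subst h; simp [hp]
  · simp [h]

/-- The ranks of `p` and `q` in `I` differ by one more than the number of elements between them. -/
theorem neg_one_pow_card_lt {d : ℕ} {I : Finset (Fin d)} {p q : Fin d} (hp : p ∈ I) (hq : q ∈ I)
    (hpq : p ≠ q) :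
    (-1 : ℂ) ^ (I.filter (· < q)).card =
      -((-1) ^ (I.filter (· < p)).card * (-1) ^ between pos I p q) := by
  have e : ∀ s : Fin d, (-1 : ℂ) ^ (I.filter (· < s)).card = ∏ r ∈ I, if r < s then -1 else 1 := by
    intro s
    rw [Finset.prod_ite, Finset.prod_const, Finset.prod_const_one, mul_one]
  have hq' : q ∈ I.erase p := Finset.mem_erase.2 ⟨hpq.symm, hq⟩
  rw [e, e, neg_one_pow_between, ← Finset.prod_mul_distrib]
  rw [← Finset.mul_prod_erase I _ hp, ← Finset.mul_prod_erase (I.erase p) _ hq',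
    ← Finset.mul_prod_erase I _ hp, ← Finset.mul_prod_erase (I.erase p) _ hq']
  have h : ∀ r ∈ (I.erase p).erase q, (if r < q then (-1 : ℂ) else 1) =
      (if r < p then -1 else 1) * (if p < r ∧ r < q ∨ q < r ∧ r < p then -1 else 1) := by
    intro r hr
    simp only [Finset.mem_erase] at hr
    rcases lt_or_gt_of_ne hr.1 with h1 | h1 <;> rcases lt_or_gt_of_ne hr.2.1 with h2 | h2 <;>
      simp [h1, h2, h1.not_gt, h2.not_gt]
  rw [Finset.prod_congr rfl h]
  rcases lt_or_gt_of_ne hpq with h1 | h1 <;> simp [h1, h1.not_gt]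

/-- A Grassmann–Plücker vector has the expansion of a Pfaffian along every row. -/
theorem GrassmannPlucker.expand {d : ℕ} {T : Finset (Fin d) → ℂ} (h : GrassmannPlucker T)
    {I : Finset (Fin d)} {p : Fin d} (hp : p ∈ I) :
    T ∅ * T I = ∑ q ∈ I.erase p,
      (-1) ^ between pos I p q * (T {p, q} * T ((I.erase p).erase q)) := by
  -- For this pair of sets the symmetric difference is `I`; its element `p` gives the left side and
  -- every other `q` a term of the expansion.
  have h1 := h {p} (I.erase p)
  rw [symmDiff_singleton_erase hp, ← Finset.add_sum_erase I _ hp, symmDiff_self,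
    symmDiff_comm (I.erase p), symmDiff_singleton_erase hp] at h1
  have h2 : ∀ q ∈ I.erase p, (-1 : ℂ) ^ (I.filter (· < q)).card *
      (T (symmDiff {p} {q}) * T (symmDiff (I.erase p) {q})) =
      -((-1) ^ (I.filter (· < p)).card *
        ((-1) ^ between pos I p q * (T {p, q} * T ((I.erase p).erase q)))) := by
    intro q hq
    have hqp := (Finset.mem_erase.1 hq).1
    have e1 : symmDiff ({p} : Finset (Fin d)) {q} = {p, q} := by
      ext i
      simp only [Finset.mem_symmDiff, Finset.mem_singleton, Finset.mem_insert]
      constructor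
      · tauto
      · rintro (rfl | rfl)
        · exact Or.inl ⟨rfl, hqp.symm⟩
        · exact Or.inr ⟨rfl, hqp⟩
    have e2 : symmDiff (I.erase p) {q} = (I.erase p).erase q := by
      ext i
      simp only [Finset.mem_symmDiff, Finset.mem_singleton, Finset.mem_erase] at hq ⊢
      by_cases h : i = q
      · subst h; simp [hq]
      · simp [h]
    rw [e1, e2, neg_one_pow_card_lt hp (Finset.mem_erase.1 hq).2 hqp.symm]
    ring
  rw [Finset.sum_congr rfl h2, Finset.sum_neg_distrib, ← Finset.mul_sum] at h1
  have h3 := neg_one_pow_mul_self (I.filter (· < p)).card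
  simp only [Finset.bot_eq_empty] at h1
  linear_combination (-1) ^ (I.filter (· < p)).card * h1 -
    (T ∅ * T I - ∑ q ∈ I.erase p,
      (-1) ^ between pos I p q * (T {p, q} * T ((I.erase p).erase q))) * h3

/-! ### Products of Grassmann–Plücker tensors -/

/-- The index with `1` at the edges in `I` and `0` elsewhere. -/
def indicator {E : Type*} [DecidableEq E] (I : Finset E) (e : E) : Fin 2 := if e ∈ I then 1 else 0

/-- The entries of the tensor at `w`, normalized so that the first one is one. -/
noncomputable def localEntry {E W : Type*} [DecidableEq E] {l : E → W}
    (F : ∀ w, Signature (Star l w)) (w : W) (I : Finset E) : ℂ :=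
  F w (fun e => indicator I e.1) / F w fun _ => 0

/-- `r` is strictly between `p` and `q`, for the order given by `f`. -/
abbrev Btw {E : Type*} (f : E → ℤ) (p q r : E) : Prop :=
  f p < f r ∧ f r < f q ∨ f q < f r ∧ f r < f p

/-- Betweenness is the cyclic condition or its negation, according to a comparison of `p` and `q`
that does not involve `r`. -/
theorem btw_iff_cyc {E : Type*} {f : E → ℤ} {p q r : E} (h1 : f p ≠ f q) (h2 : f p ≠ f r)
    (h3 : f q ≠ f r) : Btw f p q r ↔ (Cyc (f p) (f r) (f q) ↔ f p < f q) := by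
  unfold Btw Cyc
  omega

theorem not_btw_self {E : Type*} (f : E → ℤ) (p r : E) : ¬ Btw f p p r := by
  unfold Btw
  omega

theorem iff_iff_iff_comm (A B C D : Prop) :
    ((A ↔ C) ↔ (A ↔ D)) ↔ ((B ↔ C) ↔ (B ↔ D)) := by
  by_cases A <;> by_cases B <;> by_cases C <;> by_cases D <;> simp_all

theorem ite_mul_ite_eq {A B C D : Prop} [Decidable A] [Decidable B] [Decidable C] [Decidable D]
    (h : (A ↔ B) ↔ (C ↔ D)) :
    (if A then (-1 : ℂ) else 1) * (if B then -1 else 1) =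
      (if C then -1 else 1) * (if D then -1 else 1) := by
  by_cases hA : A <;> by_cases hB : B <;> by_cases hC : C <;> by_cases hD : D <;>
    simp_all

/-- The blocks `l ⁻¹' {w}` do not cross each other in the order given by `f`, and the crossings
within a block are those of its given order. -/
structure Compatible {E W : Type*} [Fintype E] [DecidableEq W] {l : E → W} (o : LocalOrders l)
    (f : E → ℤ) : Prop where
  btw_iff : ∀ {p q r s : E}, l p = l q → l r = l s → l p ≠ l r →
    (Btw f p q r ↔ Btw f p q s)
  btw_iff_localPos : ∀ {p q r s : E}, l p = l q → l p = l r → l p = l s →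
    r ≠ p → r ≠ q → s ≠ p → s ≠ q →
    ((Btw f p q r ↔ Btw (localPos o) p q r) ↔ (Btw f p q s ↔ Btw (localPos o) p q s))

theorem prod_eq_one_of_forall_eq {E : Type*} {S : Finset E} {h : E → ℂ} (hS : Even S.card)
    (hc : ∀ r ∈ S, ∀ s ∈ S, h r = h s) (h1 : ∀ r ∈ S, h r * h r = 1) : ∏ r ∈ S, h r = 1 := by
  rcases S.eq_empty_or_nonempty with rfl | ⟨s, hs⟩
  · simp
  · rw [Finset.prod_congr rfl fun r hr => hc r hr s hs, Finset.prod_const]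
    obtain ⟨k, hk⟩ := hS
    rw [hk, pow_add, ← mul_pow, h1 s hs, one_pow]

section

variable {E W : Type*} [Fintype E] [DecidableEq E] [DecidableEq W] {l : E → W}

/-- Distinct blocks do not cross, and within a block `f` and `localPos` induce the same cyclic
order. Whether their betweenness relations agree therefore depends only on `p` and `q`. -/
theorem Noncrossing.compatible (o : LocalOrders l) {f : E → ℤ} (hf : Function.Injective f)
    (h : Noncrossing f (rotation o)) : Compatible o f where
  btw_iff := by
    have key : ∀ {p q r s : E}, l p = l q → l r = l s → l p ≠ l r →
        Cyc (f p) (f r) (f q) → Cyc (f p) (f s) (f q) := by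
      intro p q r s hpq hrs hpr h1
      have n1 : f s ≠ f p := fun h' => hpr ((congrArg l (hf h')).symm.trans hrs.symm)
      have n2 : f q ≠ f s := fun h' => hpr (hpq.trans ((congrArg l (hf h')).trans hrs.symm))
      have n3 : f q ≠ f p := fun h' => not_cyc_self_right _ _ (h' ▸ h1).rotate
      have h2 := h.not_crossing hf ((sameCycle_rotation o).2 hpq) ((sameCycle_rotation o).2 hrs)
        (fun h' => hpr ((sameCycle_rotation o).1 h')) h1
      exact ((not_cyc_iff n2 n1 n3).1 h2).rotate
    intro p q r s hpq hrs hpr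
    have k1 : Cyc (f p) (f r) (f q) ↔ Cyc (f p) (f s) (f q) :=
      ⟨key hpq hrs hpr, key hpq hrs.symm (fun h' => hpr (h'.trans hrs.symm))⟩
    have n1 : f p ≠ f s := fun h' => hpr ((congrArg l (hf h')).trans hrs.symm)
    have n2 : f q ≠ f s := fun h' => hpr (hpq.trans ((congrArg l (hf h')).trans hrs.symm))
    have n3 : f p ≠ f r := fun h' => hpr (congrArg l (hf h'))
    have n4 : f q ≠ f r := fun h' => hpr (hpq.trans (congrArg l (hf h')))
    by_cases hne : p = q
    · subst hne
      simp only [not_btw_self]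
    have n5 : f p ≠ f q := fun h' => hne (hf h')
    rw [btw_iff_cyc n5 n3 n4, btw_iff_cyc n5 n1 n2, k1]
  btw_iff_localPos := by
    intro p q r s hpq hpr hps h1 h2 h3 h4
    by_cases hne : p = q
    · subst hne
      simp only [not_btw_self]
    have k1 := h.cyc_iff o hf hpr hpq h1.symm h2 hne
    have k2 := h.cyc_iff o hf hps hpq h3.symm h4 hne
    have g1 := localPos_ne o hpq hne
    have g2 := localPos_ne o hpr h1.symm
    have g3 := localPos_ne o hps h3.symm
    have g4 := localPos_ne o (hpq.symm.trans hpr) h2.symm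
    have g5 := localPos_ne o (hpq.symm.trans hps) h4.symm
    have e1 : f p ≠ f q := fun h' => hne (hf h')
    have e2 : f p ≠ f r := fun h' => h1 (hf h').symm
    have e3 : f p ≠ f s := fun h' => h3 (hf h').symm
    have e4 : f q ≠ f r := fun h' => h2 (hf h').symm
    have e5 : f q ≠ f s := fun h' => h4 (hf h').symm
    rw [btw_iff_cyc e1 e2 e4, btw_iff_cyc e1 e3 e5, btw_iff_cyc g1 g2 g4, btw_iff_cyc g1 g3 g5,
      k1, k2]
    exact iff_iff_iff_comm _ _ _ _

/-- Betweenness does not see the direction of the order; this is why one order serves generators and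
recognizers alike. -/
theorem Compatible.neg {E W : Type*} [Fintype E] [DecidableEq W] {l : E → W}
    {o : LocalOrders l} {f : E → ℤ} (h : Compatible o (-f)) :
    Compatible o f := by
  have e : ∀ p q r, Btw (-f) p q r ↔ Btw f p q r := by
    intro p q r
    simp only [Btw, Pi.neg_apply, neg_lt_neg_iff]
    tauto
  exact ⟨fun {p q r s} => by simpa only [e] using h.btw_iff (p := p) (q := q) (r := r) (s := s),
    fun {p q r s} => by
      simpa only [e] using h.btw_iff_localPos (p := p) (q := q) (r := r) (s := s)⟩

theorem Compatible.of_lt_iff {E W : Type*} [Fintype E] [DecidableEq W] {l : E → W}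
    {o : LocalOrders l} {f g : E → ℤ} (h : Compatible o f)
    (hfg : ∀ x y, g x < g y ↔ f x < f y) : Compatible o g := by
  have e : ∀ p q r, Btw g p q r ↔ Btw f p q r := by
    intro p q r
    simp only [Btw, hfg]
  exact ⟨fun {p q r s} => by simpa only [e] using h.btw_iff (p := p) (q := q) (r := r) (s := s),
    fun {p q r s} => by
      simpa only [e] using h.btw_iff_localPos (p := p) (q := q) (r := r) (s := s)⟩

theorem localEntry_congr {E W : Type*} [DecidableEq E] {l : E → W}
    (F : ∀ w, Signature (Star l w)) {w : W} {I J : Finset E}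
    (h : ∀ e, l e = w → (e ∈ I ↔ e ∈ J)) : localEntry F w I = localEntry F w J := by
  unfold localEntry indicator
  congr 2
  funext e
  simp only [h e.1 e.2]

theorem localEntry_empty {E W : Type*} [DecidableEq E] {l : E → W}
    (F : ∀ w, Signature (Star l w)) (hF0 : ∀ w, F w (fun _ => 0) ≠ 0) (w : W) :
    localEntry F w ∅ = 1 := by
  unfold localEntry indicator
  simp [hF0 w]

theorem localEntry_expand (o : LocalOrders l) (F : ∀ w, Signature (Star l w))
    (hF : ∀ w, GrassmannPlucker ((F w).vec (o w))) (hF0 : ∀ w, F w (fun _ => 0) ≠ 0)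
    {w : W} {I : Finset E} {p : E} (hp : p ∈ I) (hpw : l p = w) :
    localEntry F w I = ∑ q ∈ (I.filter (l · = w)).erase p,
      (-1) ^ between (localPos o) (I.filter (l · = w)) p q *
        (localEntry F w {p, q} * localEntry F w ((I.erase p).erase q)) := by
  let c : Finset E → Finset (Fin (Fintype.card (Star l w))) := fun I =>
    Finset.univ.filter fun i => ((o w).symm i).1 ∈ I
  have hc : ∀ (I : Finset E) (e : Star l w), o w e ∈ c I ↔ e.1 ∈ I := by
    intro I e; simp [c]
  have hloc : ∀ I, localEntry F w I = (F w).vec (o w) (c I) / F w fun _ => 0 := by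
    intro I
    unfold localEntry Signature.vec
    congr 2
    funext e
    simp only [slots, indicator, hc]
  have hc0 : (F w).vec (o w) ∅ = F w fun _ => 0 := by
    unfold Signature.vec slots
    simp
  let p' := o w ⟨p, hpw⟩
  have hp' : p' ∈ c I := (hc I _).2 hp
  have key := (hF w).expand hp'
  rw [hc0] at key
  have h0 := hF0 w
  have hkey : localEntry F w I = ∑ q ∈ (c I).erase p', (-1) ^ between pos (c I) p' q *
      ((F w).vec (o w) {p', q} / (F w fun _ => 0) *
        ((F w).vec (o w) (((c I).erase p').erase q) / F w fun _ => 0)) := by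
    rw [hloc, div_eq_iff h0, Finset.sum_mul]
    apply mul_left_cancel₀ h0
    rw [key, Finset.mul_sum]
    refine Finset.sum_congr rfl fun q _ => ?_
    field_simp
  rw [hkey]
  have hs : ∀ i, l ((o w).symm i).1 = w := fun i => ((o w).symm i).2
  have hval : ∀ i, localPos o ((o w).symm i).1 = pos i := by
    intro i
    rw [localPos_eq, Equiv.apply_symm_apply, pos]
  have hpv : ((o w).symm p').1 = p := by simp [p']
  refine Finset.sum_bij (fun i _ => ((o w).symm i).1) ?_ ?_ ?_ ?_
  · intro i hi
    rw [Finset.mem_erase] at hi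
    refine Finset.mem_erase.2 ⟨fun h' => hi.1 ?_, Finset.mem_filter.2 ⟨?_, hs i⟩⟩
    · apply (o w).symm.injective
      exact Subtype.ext (h'.trans hpv.symm)
    · rw [← hc I, Equiv.apply_symm_apply]; exact hi.2
  · intro i _ j _ h'
    exact (o w).symm.injective (Subtype.ext h')
  · intro q hq
    rw [Finset.mem_erase, Finset.mem_filter] at hq
    refine ⟨o w ⟨q, hq.2.2⟩, Finset.mem_erase.2 ⟨fun h' => hq.1 ?_, (hc I _).2 hq.2.1⟩, by simp⟩
    exact congrArg Subtype.val ((o w).injective h')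
  · intro i hi
    have e1 : between pos (c I) p' i =
        between (localPos o) (I.filter (l · = w)) p ((o w).symm i).1 := by
      unfold between
      refine Finset.card_bij (fun j _ => ((o w).symm j).1) ?_ ?_ ?_
      · intro j hj
        rw [Finset.mem_filter] at hj ⊢
        refine ⟨Finset.mem_filter.2 ⟨?_, hs j⟩, ?_⟩
        · rw [← hc I, Equiv.apply_symm_apply]; exact hj.1
        · rw [← hpv, hval, hval, hval]; exact hj.2
      · intro i _ j _ h'
        exact (o w).symm.injective (Subtype.ext h')
      · intro r hr
        rw [Finset.mem_filter, Finset.mem_filter] at hr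
        refine ⟨o w ⟨r, hr.1.2⟩, ?_, by simp⟩
        rw [Finset.mem_filter]
        refine ⟨(hc I _).2 hr.1.1, ?_⟩
        have h2 := hr.2
        rw [← hpv, hval, hval] at h2
        have h3 := hval (o w ⟨r, hr.1.2⟩)
        rw [Equiv.symm_apply_apply] at h3
        rw [← h3]
        exact h2
    have e2 : c {p, ((o w).symm i).1} = {p', i} := by
      ext j
      simp only [c, Finset.mem_filter, Finset.mem_univ, true_and, Finset.mem_insert,
        Finset.mem_singleton]
      rw [← hpv]
      simp only [← Subtype.ext_iff, EmbeddingLike.apply_eq_iff_eq]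
    have e3 : c ((I.erase p).erase ((o w).symm i).1) = ((c I).erase p').erase i := by
      ext j
      simp only [c, Finset.mem_filter, Finset.mem_univ, true_and, Finset.mem_erase]
      rw [← hpv]
      simp only [ne_eq, ← Subtype.ext_iff, EmbeddingLike.apply_eq_iff_eq]
    rw [hloc, hloc, e1, e2, e3]

/-- The expansion removes two edges at `w` at a time, and a non-zero entry has a non-zero term. -/
theorem even_card_of_localEntry_ne_zero (o : LocalOrders l) (F : ∀ w, Signature (Star l w))
    (hF : ∀ w, GrassmannPlucker ((F w).vec (o w))) (hF0 : ∀ w, F w (fun _ => 0) ≠ 0)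
    {w : W} {I : Finset E} (h : localEntry F w I ≠ 0) : Even (I.filter (l · = w)).card := by
  induction I using Finset.strongInduction with
  | H I ih =>
    rcases (I.filter (l · = w)).eq_empty_or_nonempty with h0 | ⟨p, hp⟩
    · simp [h0]
    have hpI := Finset.mem_filter.1 hp
    rw [localEntry_expand o F hF hF0 hpI.1 hpI.2] at h
    obtain ⟨q, hq, hne⟩ := Finset.exists_ne_zero_of_sum_ne_zero h
    have h1 := ih ((I.erase p).erase q)
      ((Finset.erase_subset _ _).trans_ssubset (Finset.erase_ssubset hpI.1))
      (fun h' => hne (by rw [h']; ring))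
    have h2 : ((I.erase p).erase q).filter (l · = w) =
        ((I.filter (l · = w)).erase p).erase q := by
      ext i; simp only [Finset.mem_filter, Finset.mem_erase]; tauto
    rw [h2] at h1
    rw [← Finset.card_erase_add_one hp, ← Finset.card_erase_add_one hq, add_assoc]
    exact h1.add (by decide)

/-- At another vertex either all edges of `I` or none lie between `p` and `q`, and their number is
even. At the vertex of `p` and `q`, the global and local factors agree for all remaining edges or
differ for all of them, and again there is an even number of these. -/
theorem Compatible.neg_one_pow_between [Fintype W] {o : LocalOrders l} {f : E → ℤ}
    (h : Compatible o f) {I : Finset E} {p q : E} (hp : p ∈ I) (hq : q ∈ I) (hpq : p ≠ q)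
    (hl : l p = l q) (hev : ∀ w, Even (I.filter (l · = w)).card) :
    (-1 : ℂ) ^ between f I p q =
      (-1) ^ between (localPos o) (I.filter (l · = l p)) p q := by
  have e : ∀ (g : E → ℤ) (J : Finset E), (-1 : ℂ) ^ between g J p q =
      ∏ r ∈ J, if Btw g p q r then -1 else 1 := by
    intro g J
    rw [Finset.prod_ite, Finset.prod_const, Finset.prod_const_one, mul_one]
    rfl
  have hfib := Finset.prod_fiberwise I l (fun r => if Btw f p q r then (-1 : ℂ) else 1)
  rw [e, e, ← hfib, ← Finset.mul_prod_erase _ _ (Finset.mem_univ (l p))]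
  rw [Finset.prod_eq_one (s := Finset.univ.erase (l p)), mul_one]
  · have hsq : (∏ r ∈ I with l r = l p, if Btw (localPos o) p q r then (-1 : ℂ) else 1) *
        (∏ r ∈ I with l r = l p, if Btw (localPos o) p q r then (-1 : ℂ) else 1) = 1 := by
      rw [← Finset.prod_mul_distrib]
      exact Finset.prod_eq_one fun r _ => by split_ifs <;> norm_num
    have hmul : (∏ r ∈ I with l r = l p, if Btw f p q r then (-1 : ℂ) else 1) *
        (∏ r ∈ I with l r = l p, if Btw (localPos o) p q r then (-1 : ℂ) else 1) = 1 := by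
      have hp' : p ∈ I.filter (l · = l p) := Finset.mem_filter.2 ⟨hp, rfl⟩
      have hq' : q ∈ (I.filter (l · = l p)).erase p :=
        Finset.mem_erase.2 ⟨hpq.symm, Finset.mem_filter.2 ⟨hq, hl.symm⟩⟩
      have hev' : Even (((I.filter (l · = l p)).erase p).erase q).card := by
        have := hev (l p)
        rw [← Finset.card_erase_add_one hp', ← Finset.card_erase_add_one hq'] at this
        rw [add_assoc] at this
        exact (Nat.even_add.1 this).2 (by decide)
      rw [← Finset.prod_mul_distrib, ← Finset.mul_prod_erase _ _ hp',
        ← Finset.mul_prod_erase _ _ hq', prod_eq_one_of_forall_eq hev']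
      · simp [Btw]
      · intro r hr s hs
        simp only [Finset.mem_erase, Finset.mem_filter] at hr hs
        have k := h.btw_iff_localPos hl hr.2.2.2.symm hs.2.2.2.symm hr.2.1 hr.1 hs.2.1 hs.1
        exact ite_mul_ite_eq k
      · intro r _
        split_ifs <;> norm_num
    exact mul_right_cancel₀ (right_ne_zero_of_mul_eq_one hsq) (hmul.trans hsq.symm)
  · intro w hw
    have hwp := Finset.ne_of_mem_erase hw
    refine prod_eq_one_of_forall_eq (hev w) ?_ ?_
    · intro r hr s hs
      have hr' := (Finset.mem_filter.1 hr).2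
      have hs' := (Finset.mem_filter.1 hs).2
      simp only [h.btw_iff hl (hr'.trans hs'.symm) (fun h' => hwp (h'.trans hr').symm)]
    · intro r _
      split_ifs <;> norm_num

/-- The product of the tensors at the blocks has the expansion of a Pfaffian along every row. -/
theorem Compatible.prod_localEntry_expand [Fintype W] {o : LocalOrders l} {f : E → ℤ}
    (h : Compatible o f) (F : ∀ w, Signature (Star l w))
    (hF : ∀ w, GrassmannPlucker ((F w).vec (o w))) (hF0 : ∀ w, F w (fun _ => 0) ≠ 0)
    {I : Finset E} {p : E} (hp : p ∈ I) :
    ∏ w, localEntry F w I = ∑ q ∈ I.erase p, (-1) ^ between f I p q *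
      ((∏ w, localEntry F w {p, q}) * ∏ w, localEntry F w ((I.erase p).erase q)) := by
  have hsub : (I.filter (l · = l p)).erase p ⊆ I.erase p :=
    Finset.erase_subset_erase _ (Finset.filter_subset _ _)
  -- Terms with `q` at another vertex vanish: the set `{p, q}` has just one edge at the vertex of
  -- `p`, and entries at odd sets are zero.
  rw [← Finset.sum_subset hsub]
  · rw [← Finset.mul_prod_erase _ _ (Finset.mem_univ (l p)),
      localEntry_expand o F hF hF0 hp rfl, Finset.sum_mul]
    refine Finset.sum_congr rfl fun q hq => ?_
    simp only [Finset.mem_erase, Finset.mem_filter] at hq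
    have h1 : ∏ w, localEntry F w {p, q} = localEntry F (l p) {p, q} := by
      rw [← Finset.mul_prod_erase _ _ (Finset.mem_univ (l p)), Finset.prod_eq_one, mul_one]
      intro w hw
      rw [← localEntry_empty F hF0 w]
      apply localEntry_congr
      intro e he
      simp only [Finset.mem_insert, Finset.mem_singleton, Finset.notMem_empty, iff_false]
      rintro (rfl | rfl)
      · exact Finset.ne_of_mem_erase hw he.symm
      · exact Finset.ne_of_mem_erase hw (he.symm.trans hq.2.2)
    have h2 : ∏ w, localEntry F w ((I.erase p).erase q) =
        localEntry F (l p) ((I.erase p).erase q) *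
          ∏ w ∈ Finset.univ.erase (l p), localEntry F w I := by
      rw [← Finset.mul_prod_erase _ _ (Finset.mem_univ (l p))]
      congr 1
      refine Finset.prod_congr rfl fun w hw => ?_
      apply localEntry_congr
      intro e he
      have n1 : e ≠ p := by
        rintro rfl; exact Finset.ne_of_mem_erase hw he.symm
      have n2 : e ≠ q := by
        rintro rfl; exact Finset.ne_of_mem_erase hw (he.symm.trans hq.2.2)
      simp [n1, n2]
    rw [h1, h2]
    -- The signs agree only if `I` has an even number of edges at every vertex. If this product is
    -- non-zero, that holds; otherwise the terms vanish on both sides.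
    by_cases hz : localEntry F (l p) ((I.erase p).erase q) *
          ∏ w ∈ Finset.univ.erase (l p), localEntry F w I = 0
    · rw [hz]
      linear_combination (-1) ^ between (localPos o) (I.filter (l · = l p)) p q *
        localEntry F (l p) {p, q} * hz
    · have hz1 := left_ne_zero_of_mul hz
      have hz2 := Finset.prod_ne_zero_iff.1 (right_ne_zero_of_mul hz)
      have hev : ∀ w, Even (I.filter (l · = w)).card := by
        intro w
        by_cases hw : w = l p
        · subst hw
          have k := even_card_of_localEntry_ne_zero o F hF hF0 hz1
          have e : ((I.erase p).erase q).filter (l · = l p) =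
              ((I.filter (l · = l p)).erase p).erase q := by
            ext i; simp only [Finset.mem_filter, Finset.mem_erase]; tauto
          rw [e] at k
          have hp' : p ∈ I.filter (l · = l p) := Finset.mem_filter.2 ⟨hp, rfl⟩
          have hq' : q ∈ (I.filter (l · = l p)).erase p :=
            Finset.mem_erase.2 ⟨hq.1, Finset.mem_filter.2 hq.2⟩
          rw [← Finset.card_erase_add_one hp', ← Finset.card_erase_add_one hq', add_assoc]
          exact k.add (by decide)
        · exact even_card_of_localEntry_ne_zero o F hF hF0
            (hz2 w (Finset.mem_erase.2 ⟨hw, Finset.mem_univ _⟩))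
      rw [h.neg_one_pow_between hp hq.2.1 (Ne.symm hq.1) hq.2.2.symm hev]
      ring
  · intro q hq hq'
    simp only [Finset.mem_erase, Finset.mem_filter, not_and] at hq hq'
    have hlq : l q ≠ l p := hq' hq.1 hq.2
    have h1 : localEntry F (l p) {p, q} = 0 := by
      by_contra hne
      have k := even_card_of_localEntry_ne_zero o F hF hF0 hne
      have e : ({p, q} : Finset E).filter (l · = l p) = {p} := by
        ext i
        simp only [Finset.mem_filter, Finset.mem_insert, Finset.mem_singleton]
        constructor
        · rintro ⟨rfl | rfl, h'⟩
          · rfl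
          · exact absurd h' hlq
        · rintro rfl; exact ⟨Or.inl rfl, rfl⟩
      rw [e] at k
      simp at k
    rw [Finset.prod_eq_zero (Finset.mem_univ (l p)) h1]
    ring

/-- In a compatible order, a product of Grassmann–Plücker tensors is a vector of
sub-Pfaffians. -/
theorem Compatible.exists_sPf [Fintype W] {o : LocalOrders l} {n : ℕ} {O : E ≃ Fin n}
    (h : Compatible o fun e => pos (O e)) (F : ∀ w, Signature (Star l w))
    (hF : ∀ w, GrassmannPlucker ((F w).vec (o w))) (hF0 : ∀ w, F w (fun _ => 0) ≠ 0) :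
    ∃ z : Matrix (Fin n) (Fin n) ℂ, z.transpose = -z ∧
      ∀ J, (∏ w, F w fun e => slots O J e.1) / ∏ w, F w (fun _ => 0) = sPf z J := by
  let T : Finset (Fin n) → ℂ := fun J => ∏ w, localEntry F w (J.map O.symm.toEmbedding)
  have hT : T = sPf (skewOf T) := by
    apply eq_sPf_of_expand
    · simp [T, localEntry_empty F hF0]
    · intro J p hp hmin
      have key := h.prod_localEntry_expand F hF hF0
        (I := J.map O.symm.toEmbedding) (p := O.symm p) (by simpa using hp)
      have e1 : (J.map O.symm.toEmbedding).erase (O.symm p) =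
          (J.erase p).map O.symm.toEmbedding := by
        rw [Finset.map_erase]; rfl
      rw [e1, Finset.sum_map] at key
      rw [show T J = _ from key]
      refine Finset.sum_congr rfl fun q hq => ?_
      have hpq : p < q := lt_of_le_of_ne (hmin q (Finset.mem_erase.1 hq).2)
        (Finset.mem_erase.1 hq).1.symm
      have e2 : ({p, q} : Finset (Fin n)).map O.symm.toEmbedding = {O.symm p, O.symm q} := by
        simp [Finset.map_insert]
      have e3 : ((J.erase p).map O.symm.toEmbedding).erase (O.symm q) =
          ((J.erase p).erase q).map O.symm.toEmbedding := by
        rw [Finset.map_erase _ (J.erase p)]; rfl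
      have e4 : between (fun e => pos (O e)) (J.map O.symm.toEmbedding) (O.symm p) (O.symm q) =
          between pos J p q := by
        unfold between
        rw [Finset.filter_map, Finset.card_map]
        congr 1
        ext i
        simp
      simp only [Equiv.coe_toEmbedding, skewOf, hpq, if_true, T]
      rw [e2, e3, e4]
  refine ⟨skewOf T, skewOf_transpose T, fun J => ?_⟩
  rw [← hT, ← Finset.prod_div_distrib]
  refine Finset.prod_congr rfl fun w _ => ?_
  unfold localEntry
  congr 2
  funext e
  simp [slots, indicator, Finset.mem_map_equiv]

end

/-! ### Valid orders -/

theorem exists_equiv_fin_of_injective {E : Type*} [Fintype E] {f : E → ℤ}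
    (hf : Function.Injective f) :
    ∃ O : E ≃ Fin (Fintype.card E), ∀ x y, pos (O x) < pos (O y) ↔ f x < f y := by
  let : LinearOrder E := LinearOrder.lift' f hf
  refine ⟨(Fintype.orderIsoFinOfCardEq E rfl).symm.toEquiv, fun x y => ?_⟩
  have h := (Fintype.orderIsoFinOfCardEq E rfl).symm.lt_iff_lt (x := x) (y := y)
  simp only [pos, Nat.cast_lt, Fin.val_fin_lt]
  exact h

theorem Signature.IsSymmetric.vec_eq {S : Type*} {n : ℕ} {T : Signature S} (h : T.IsSymmetric)
    (o o' : S ≃ Fin n) : T.vec o' = T.vec o := by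
  funext I
  have e : slots o' I = slots o I ∘ (o'.trans o.symm) := by
    funext e
    simp [slots]
  unfold Signature.vec
  rw [e]
  exact h _ _

theorem Signature.IsSymmetric.covec_eq {S : Type*} {n : ℕ} {T : Signature S} (h : T.IsSymmetric)
    (o p : S ≃ Fin n) : T.covec p = T.covec o :=
  funext fun I => congrFun (h.vec_eq o p) Iᶜ

/-- The tensor with `0` and `1` exchanged. -/
def Signature.flip {S : Type*} (T : Signature S) : Signature S := fun ε => T fun e => 1 - ε e

theorem one_sub_slots {S : Type*} {n : ℕ} (o : S ≃ Fin n) (I : Finset (Fin n)) (e : S) :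
    1 - slots o I e = slots o Iᶜ e := by
  unfold slots
  by_cases h : o e ∈ I <;> simp [h]

theorem Signature.vec_flip {S : Type*} {n : ℕ} (T : Signature S) (o : S ≃ Fin n) :
    T.flip.vec o = T.covec o := by
  funext I
  simp only [Signature.vec, Signature.covec, Signature.flip, one_sub_slots]

/-- A formulation whose tensors satisfy the Grassmann–Plücker identities for the orders of a plane
embedding has a valid order. -/
theorem Formulation.exists_isValidOrder {V U E : Type*} [Fintype V] [Fintype U] [Fintype E]
    [DecidableEq V] [DecidableEq U] [DecidableEq E] (Φ : Formulation V U E)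
    (oV : LocalOrders Φ.left) (oU : LocalOrders Φ.right)
    (hG : ∀ v, GrassmannPlucker ((Φ.G v).vec (oV v)))
    (hR : ∀ u, GrassmannPlucker ((Φ.R u).covec (oU u)))
    (hG0 : ∀ v, Φ.G v (fun _ => 0) ≠ 0) (hR1 : ∀ u, Φ.R u (fun _ => 1) ≠ 0)
    (h : IsPlaneOrders oV oU) : ∃ o, Φ.IsValidOrder o := by
  have hg : GenusZero (rotation oV) (rotation oU) := h.ge
  obtain ⟨f, hf, h1, h2⟩ := hg.hasNoncrossingOrder
  obtain ⟨O, hO⟩ := exists_equiv_fin_of_injective hf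
  have c1 : Compatible oV fun e => pos (O e) := (h1.compatible oV hf).of_lt_iff hO
  have c2 : Compatible oU fun e => pos (O e) :=
    (h2.compatible oU (fun x y hxy => hf (neg_injective hxy))).neg.of_lt_iff hO
  obtain ⟨z, hz, hz'⟩ := c1.exists_sPf Φ.G hG hG0
  -- Exchanging `0` and `1` turns complementary indexing into the ordinary one.
  obtain ⟨y, hy, hy'⟩ := c2.exists_sPf (fun u => (Φ.R u).flip)
    (fun u => by rw [Signature.vec_flip]; exact hR u)
    (fun u => by simpa [Signature.flip] using hR1 u)
  refine ⟨O, z, y, hz, hy, funext hz', funext fun J => ?_⟩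
  rw [sPfDual, ← hy']
  simp only [Signature.flip, one_sub_slots, compl_compl, sub_zero]
  rfl

end Holographic

theorem mainTheorem1 {V U E : Type*} [Fintype V] [Fintype U] [Fintype E]
    [DecidableEq V] [DecidableEq U] [DecidableEq E]
    (Φ : Holographic.Formulation V U E) (M : GL (Fin 2) ℂ)
    (oV : Holographic.LocalOrders Φ.left) (oU : Holographic.LocalOrders Φ.right)
    (hG : ∀ v, Holographic.GrassmannPlucker (((Φ.rebase M).G v).vec (oV v)))
    (hR : ∀ u, Holographic.GrassmannPlucker (((Φ.rebase M).R u).covec (oU u)))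
    (hG0 : ∀ v, (Φ.rebase M).G v (fun _ => 0) ≠ 0)
    (hR1 : ∀ u, (Φ.rebase M).R u (fun _ => 1) ≠ 0) :
    (∀ o : E ≃ Fin (Fintype.card E), (Φ.rebase M).IsValidOrder o →
      Φ.pairing = (Φ.rebase M).alpha * (Φ.rebase M).beta *
        Holographic.pfaffian
          (Holographic.tilde ((Φ.rebase M).xMatrix o) + (Φ.rebase M).yMatrix o) ∧
      ∀ P : Holographic.SatProblem V U E, P.formulation = Φ →
        (P.numSat : ℂ) = (Φ.rebase M).alpha * (Φ.rebase M).beta *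
          Holographic.pfaffian
            (Holographic.tilde ((Φ.rebase M).xMatrix o) + (Φ.rebase M).yMatrix o)) ∧
    (Holographic.IsPlaneOrders oV oU →
      ∃ o : E ≃ Fin (Fintype.card E), (Φ.rebase M).IsValidOrder o) ∧
    (Holographic.IsPlanar Φ.left Φ.right →
      (∀ v, ((Φ.rebase M).G v).IsSymmetric) → (∀ u, ((Φ.rebase M).R u).IsSymmetric) →
      ∃ o : E ≃ Fin (Fintype.card E), (Φ.rebase M).IsValidOrder o) := by
  refine ⟨fun o ho => ?_, fun hplane => ?_, ?_⟩
  · have h := (Φ.rebase M).pairing_eq_pfaffian (Finset.prod_ne_zero_iff.2 fun v _ => hG0 v)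
      (Finset.prod_ne_zero_iff.2 fun u _ => hR1 u) ho
    rw [Φ.pairing_rebase M] at h
    refine ⟨h, fun P hP => ?_⟩
    rw [← h, ← hP, P.pairing_formulation]
  · exact (Φ.rebase M).exists_isValidOrder oV oU hG hR hG0 hR1 hplane
  · rintro ⟨oV', oU', hplane⟩ hGs hRs
    -- A symmetric tensor has the same vector in all orders, so the identities pass from the given
    -- orders to those of an embedding.
    refine (Φ.rebase M).exists_isValidOrder oV' oU' (fun v => ?_) (fun u => ?_) hG0 hR1 hplane
    · have h := (hGs v).vec_eq (oV v) (oV' v)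
      exact (congrArg Holographic.GrassmannPlucker h).mpr (hG v)
    · have h := (hRs u).covec_eq (oU u) (oU' u)
      exact (congrArg Holographic.GrassmannPlucker h).mpr (hR u)
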